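/- Graphs are finite and undirected, with parallel edges allowed. Write $c(H)$ for the number of connected components of a graph $H$ and $H-A$ for the graph obtained from $H$ by deleting the edges in $A$. A bridge is an edge whose deletion increases $c$. Let $G=(V,E)$ be a connected, loopless and bridgeless graph with $n$ vertices and $m$ edges. For $A\subseteq E$ put $\rho(A)=n-c(V,A)$ and $\gamma(A)=|A|-n+c(V,A)$. Let $t_{i,j}$ be the coefficient of $x^iy^j$ in the Tutte polynomial $T(G;x,y)=\sum_{A\subseteq E}(x-1)^{\rho(E)-\rho(A)}(y-1)^{\gamma(A)}$, with $t_{i,j}=0$ if $i<0$ or $j<0$. A series class of a (possibly disconnected) bridgeless loopless graph $H$ is a maximal nonempty set $C$ of edges of $H$ such that deleting any two distinct edges of $C$ from $H$ increases the number of connected components. It is nontrivial if $|C|\ge 2$. Let $s(H)$ be the number of series classes of $H$, and let $s^*(G)$ be the number of nontrivial series classes of $G$. For integers $k_1,k_2,k_3\ge 1$, let $\Theta_{k_1,k_2,k_3}$ be the graph consisting of two vertices $u\neq v$ connected by three internally disjoint paths of lengths $k_1,k_2,k_3$. A set $C\subseteq E$ is a $\Theta$ class of $G$ if, for some $k_1,k_2,k_3\ge1$,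 each of the $k_1+k_2+k_3-1$ connected components of $G-C$ is bridgeless, and contracting each of these components to a single vertex turns $G$ into a graph isomorphic to $\Theta_{k_1,k_2,k_3}$ whose edges are exactly the edges in $C$. Let $\Theta(G)$ be the number of $\Theta$ classes of $G$. Then 1. $t_{0,m-n+1}=1$; 2. $t_{0,m-n}=n+s(G)-m-1$; 3. $t_{0,m-n-1}=\binom{m-n+1}{2}-(m-n)\,s(G)+\binom{s(G)}{2}-\Theta(G)$; 4. $t_{1,m-n}=s^*(G)$; 5. $t_{1,m-n-1}=-s^*(G)(m-n)+\sum_{A}s(G-A)+\Theta(G)$, where the sum is over all nontrivial series classes $A$ of $G$. -/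

import Mathlib

namespace Graph

variable {α β : Type*}

/-- The number `c(G)` of connected components of a multigraph. (Passing to the underlying simple
graph, which only forgets loops and multiplicities, does not affect connectivity.) -/
noncomputable def numComponents (G : Graph α β) : ℕ :=
  Nat.card G.toSimpleGraph.ConnectedComponent

/-- A multigraph is connected if it has a vertex and any two of its vertices are joined by
a walk. -/
def IsConnected (G : Graph α β) : Prop := G.toSimpleGraph.Connected

/-- A bridge is an edge whose deletion increases the number of connected components. -/
def IsBridge (G : Graph α β) (e : β) : Prop :=
  e ∈ G.edgeSet ∧ G.numComponents < (G.deleteEdges {e}).numComponents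

/-- A multigraph is bridgeless if none of its edges is a bridge. -/
def IsBridgeless (G : Graph α β) : Prop := ∀ e, ¬ G.IsBridge e

/-! ### The Tutte polynomial -/

/-- The rank `ρ(A) = n - c(A)` of a set `A` of edges, `c(A)` being the number of components of the
spanning subgraph with edge set `A`. -/
noncomputable def edgeRank (G : Graph α β) (A : Set β) : ℕ :=
  G.vertexSet.ncard - (G.restrict A).numComponents

/-- The nullity `γ(A) = |A| - n + c(A)` of a set `A` of edges. -/
noncomputable def edgeNullity (G : Graph α β) (A : Set β) : ℕ :=
  A.ncard + (G.restrict A).numComponents - G.vertexSet.ncard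

open Polynomial in
/-- The Tutte polynomial
`T(G; x, y) = ∑_{A ⊆ E} (x - 1) ^ (ρ(E) - ρ(A)) * (y - 1) ^ γ(A)` of a finite multigraph,
as a polynomial in `y` (the outer variable) over the polynomial ring `ℤ[x]`. -/
noncomputable def tuttePoly (G : Graph α β) : Polynomial (Polynomial ℤ) :=
  ∑ᶠ A ∈ 𝒫 G.edgeSet,
    (C X - 1) ^ (G.edgeRank G.edgeSet - G.edgeRank A) * (X - 1) ^ G.edgeNullity A

/-- The coefficient `t_{i,j}` of `x ^ i * y ^ j` in the Tutte polynomial, for integers `i`, `j`;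
it is `0` if one of the exponents is negative. -/
noncomputable def tutteCoeff (G : Graph α β) (i j : ℤ) : ℤ :=
  if 0 ≤ i ∧ 0 ≤ j then (G.tuttePoly.coeff j.toNat).coeff i.toNat else 0

/-! ### Series classes -/

/-- A series class: a maximal (nonempty) set `C` of edges such that the deletion of any two
distinct edges of `C` increases the number of connected components. -/
def IsSeriesClass (G : Graph α β) (C : Set β) : Prop :=
  Maximal (fun D : Set β ↦ D.Nonempty ∧ D ⊆ G.edgeSet ∧
    ∀ e ∈ D, ∀ f ∈ D, e ≠ f → G.numComponents < (G.deleteEdges {e, f}).numComponents) C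

/-- A series class is nontrivial if it has more than one edge. -/
def IsNontrivialSeriesClass (G : Graph α β) (C : Set β) : Prop :=
  G.IsSeriesClass C ∧ C.Nontrivial

/-- The number `s(G)` of series classes. -/
noncomputable def numSeriesClasses (G : Graph α β) : ℕ := {C | G.IsSeriesClass C}.ncard

/-- The number `s*(G)` of nontrivial series classes. -/
noncomputable def numNontrivialSeriesClasses (G : Graph α β) : ℕ :=
  {C | G.IsNontrivialSeriesClass C}.ncard

/-! ### Theta graphs and Theta classes -/

/-- Names for the vertices of theta graphs: the two branch vertices `u` and `v`, and the `j`-th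
inner vertex of the `i`-th path. -/
inductive ThetaVertex
  | u
  | v
  | inner (i : Fin 3) (j : ℕ)

/-- The vertex at distance `j` from `u` along the `i`-th path, a path of length `k i` from `u`
to `v`. -/
def thetaPoint (k : Fin 3 → ℕ) (i : Fin 3) (j : ℕ) : ThetaVertex :=
  if j = 0 then .u else if j = k i then .v else .inner i j

/-- For `k i ≥ 1`, the graph `Θ_{k 0, k 1, k 2}`: two vertices `u`, `v` connected by three
internally disjoint paths of lengths `k 0`, `k 1`, `k 2`. The edge `(i, j)`, for `j < k i`, joins
the `j`-th and the `(j+1)`-st vertex of the `i`-th path. -/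
def thetaGraph (k : Fin 3 → ℕ) : Graph ThetaVertex (Fin 3 × ℕ) where
  vertexSet := {x | ∃ i, ∃ j ≤ k i, x = thetaPoint k i j}
  edgeSet := {e | e.2 < k e.1}
  IsLink e x y := e.2 < k e.1 ∧
    s(x, y) = s(thetaPoint k e.1 e.2, thetaPoint k e.1 (e.2 + 1))
  isLink_symm _ _ := ⟨fun _ _ h ↦ ⟨h.1, Sym2.eq_swap.trans h.2⟩⟩
  eq_or_eq_of_isLink_of_isLink e x y z w h h' := by
    have h2 := h.2.trans h'.2.symm
    rw [Sym2.eq_iff] at h2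
    tauto
  edge_mem_iff_exists_isLink e := ⟨fun h ↦ ⟨_, _, h, rfl⟩, fun ⟨_, _, h⟩ ↦ h.1⟩
  left_mem_of_isLink e x y h := by
    obtain ⟨h1, h2⟩ := h
    rw [Sym2.eq_iff] at h2
    rcases h2 with h2 | h2
    · exact ⟨e.1, e.2, h1.le, h2.1⟩
    · exact ⟨e.1, e.2 + 1, h1, h2.1⟩

/-- A Theta class of `G`: a set `C` of edges such that, for some `k 0, k 1, k 2 ≥ 1`, the graph `G`
arises from `Θ_{k 0, k 1, k 2}` by putting pairwise disjoint connected bridgeless graphs in place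
of its vertices, with `C` corresponding to the edges of `Θ_{k 0, k 1, k 2}`.
The map `φ` sends every vertex of `G` to the vertex of the theta graph whose piece contains it, so
that the `k 0 + k 1 + k 2 - 1` components of `G - C` are the fibres of `φ`; the map `ψ` identifies
`C` with the edge set of the theta graph. -/
def IsThetaClass (G : Graph α β) (C : Set β) : Prop :=
  C ⊆ G.edgeSet ∧ (G.deleteEdges C).IsBridgeless ∧
  ∃ k : Fin 3 → ℕ, (∀ i, 1 ≤ k i) ∧
  ∃ (φ : α → ThetaVertex) (ψ : β → Fin 3 × ℕ),
    Set.MapsTo φ G.vertexSet (thetaGraph k).vertexSet ∧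
    Set.SurjOn φ G.vertexSet (thetaGraph k).vertexSet ∧
    Set.BijOn ψ C (thetaGraph k).edgeSet ∧
    (∀ e ∈ C, ∀ x y, G.IsLink e x y → (thetaGraph k).IsLink (ψ e) (φ x) (φ y)) ∧
    (∀ x y : (G.deleteEdges C).vertexSet,
      φ x = φ y ↔ (G.deleteEdges C).toSimpleGraph.Reachable x y)

/-- The number `Θ(G)` of Theta classes. -/
noncomputable def numThetaClasses (G : Graph α β) : ℕ := {C | G.IsThetaClass C}.ncard

end Graph

/-!
The proof reads the Tutte polynomial off the cographic matroid of `G`, represented over the field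
with two elements. Let `W` be the space of functions from the edges to `ZMod 2` modulo the cuts,
and let `x e` be the class in `W` of the indicator of the edge `e` (`Graph.edgeVector`). Deleting
a set `B` of edges creates exactly `|B| - ρ(B)` new components, where `ρ(B)` is the rank of the
vectors `x e` with `e ∈ B` (`Graph.numComponents_deleteEdges_add_binRank`). As `G` is bridgeless,
all these vectors are nonzero; over two elements, two nonzero vectors are parallel only if they
are equal, so the series classes of `G` are the fibres of `x`, and `s(G)` is the size of the set
`X` of the vectors `x e`.

Passing to complements, `T(G; x, y) = ∑_B (x - 1) ^ (|B| - ρ(B)) (y - 1) ^ (r - ρ(B))` with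
`r = m - n + 1`. The rank only depends on the image `S ⊆ X` of `B`, and summing over all `B` with image
`S` gives `(x - 1) ^ (|S| - ρ(S)) ∏_{a ∈ S} (1 + x + ⋯ + x ^ (k_a - 1))`, where `k_a` is the size
of the fibre over `a`. The coefficients of `y ^ r`, `y ^ (r - 1)`, `y ^ (r - 2)` only involve sets
`S` of rank at most two. A plane over two elements has three nonzero vectors, so these are the
empty set, the points, the pairs, and the lines, that is, the triples `{a, b, a + b} ⊆ X`. This
yields all five coefficients in terms of `|X|`, the number of lines and the number of lines
through a point (`corankNullityCoeff_extremal`). For a series class `A` with vector `a`, the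
series classes of `G - A` are the classes of `X \ {a}` modulo `a`, so there are `|X| - 1` of them
minus the number of lines through `a`.

It remains to see that the theta classes are the preimages of the lines. In a theta class, the
cuts around the vertices of the theta graph show that the edge vectors are constant on each of the
three paths and that the three values sum to zero. Conversely, given a line, contract the
components of the complement of its preimage `F`. The resulting multigraph has `|F| - 1` vertices;
with its edges coloured by their three vectors, its cuts meet the three colours in the same parity, and any three edges of distinct colours form a
cut. By the handshake lemma exactly two vertices have odd degree in the colours, these have degree
three, and all other vertices are met twice by a single colour. Each colour contains a path
between the two odd vertices, and the edges of the colour outside this path have even degree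
everywhere, so they are orthogonal to all cuts; hence there are none, and the multigraph is a
theta graph (`HasThetaCuts.exists_theta`).
-/

open Module

/-! ### Binary vectors of small rank -/

theorem sum_sum_eq_sum_mul_card {W : Type*} [DecidableEq W] (X : Finset W) (F : Finset (Finset W))
    (hF : ∀ S ∈ F, S ⊆ X) (w : W → ℤ) :
    ∑ S ∈ F, ∑ a ∈ S, w a = ∑ a ∈ X, w a * (F.filter (a ∈ ·)).card := by
  rw [Finset.sum_comm' (s' := fun a => F.filter (a ∈ ·)) (t' := X)]
  · simp [mul_comm]
  · intro S a
    simp only [Finset.mem_filter]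
    exact ⟨fun h => ⟨h, hF S h.1 h.2⟩, fun h => h.1⟩

theorem card_pairs_filter_mem {W : Type*} [DecidableEq W] {X : Finset W} {a : W} (ha : a ∈ X) :
    ((X.powersetCard 2).filter (a ∈ ·)).card = X.card - 1 := by
  rw [← Finset.card_erase_of_mem ha]
  symm
  refine Finset.card_nbij (fun b => {a, b}) ?_ ?_ ?_
  · intro b hb
    have hb := Finset.mem_erase.mp hb
    simp only [Finset.coe_filter, Finset.mem_powersetCard, Set.mem_ofPred_eq]
    refine ⟨⟨?_, Finset.card_pair hb.1.symm⟩, by simp⟩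
    intro z hz
    simp only [Finset.mem_insert, Finset.mem_singleton] at hz
    rcases hz with rfl | rfl
    exacts [ha, hb.2]
  · intro b hb b' hb' h
    have hb := (Finset.mem_erase.mp hb).1
    have : b ∈ ({a, b'} : Finset W) := by
      rw [← show ({a, b} : Finset W) = {a, b'} from h]
      simp
    simp only [Finset.mem_insert, Finset.mem_singleton] at this
    tauto
  · intro S hS
    simp only [Finset.coe_filter, Finset.mem_powersetCard, Set.mem_ofPred_eq] at hS
    obtain ⟨⟨hSX, hS2⟩, haS⟩ := hS
    obtain ⟨b, hb⟩ := Finset.card_eq_one.mp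
      (show (S.erase a).card = 1 by rw [Finset.card_erase_of_mem haS, hS2])
    have hbS : b ∈ S.erase a := by simp [hb]
    refine ⟨b, ?_, ?_⟩
    · have := Finset.mem_erase.mp hbS
      simp [this.1, hSX this.2]
    · rw [← Finset.insert_erase haS, hb]

section BinaryRank

variable {W : Type*} [AddCommGroup W] [Module (ZMod 2) W]

/-- The rank of a finite set of vectors over the field with two elements. -/
noncomputable def binRank (S : Finset W) : ℕ :=
  finrank (ZMod 2) (Submodule.span (ZMod 2) (S : Set W))

theorem binRank_le_card (S : Finset W) : binRank S ≤ S.card :=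
  finrank_span_finset_le_card S

theorem binRank_mono {S T : Finset W} (h : S ⊆ T) : binRank S ≤ binRank T := by
  have : FiniteDimensional (ZMod 2) (Submodule.span (ZMod 2) (T : Set W)) :=
    FiniteDimensional.span_finset _ T
  exact Submodule.finrank_mono (Submodule.span_mono (by exact_mod_cast h))

@[simp] theorem binRank_empty : binRank (∅ : Finset W) = 0 := by simp [binRank]

theorem add_self_of_binary (a : W) : a + a = 0 := by
  rw [← two_smul (ZMod 2) a, show (2 : ZMod 2) = 0 from rfl, zero_smul]

theorem add_eq_zero_iff_of_binary {a b : W} : a + b = 0 ↔ a = b := by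
  constructor
  · intro h
    rw [← add_zero a, ← add_self_of_binary b, ← add_assoc, h, zero_add]
  · rintro rfl
    exact add_self_of_binary a

theorem add_eq_iff_of_binary {a b c : W} : a + b = c ↔ a + b + c = 0 :=
  add_eq_zero_iff_of_binary.symm

/-- A subspace of dimension `d` over the field with two elements has `2 ^ d - 1` nonzero
vectors. -/
theorem card_lt_two_pow_binRank {S T : Finset W} (h0 : 0 ∉ T)
    (hT : ∀ a ∈ T, a ∈ Submodule.span (ZMod 2) (S : Set W)) : T.card < 2 ^ binRank S := by
  classical
  have : FiniteDimensional (ZMod 2) (Submodule.span (ZMod 2) (S : Set W)) :=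
    FiniteDimensional.span_finset _ S
  have : Finite (Submodule.span (ZMod 2) (S : Set W)) := Module.finite_of_finite (ZMod 2)
  have hc : Nat.card (Submodule.span (ZMod 2) (S : Set W)) = 2 ^ binRank S := by
    rw [Module.natCard_eq_pow_finrank (K := ZMod 2)]
    simp [binRank]
  have h1 : (insert 0 T).card ≤ Nat.card (Submodule.span (ZMod 2) (S : Set W)) := by
    have hsub : ((insert 0 T : Finset W) : Set W) ⊆ Submodule.span (ZMod 2) (S : Set W) := by
      intro a ha
      simp only [Finset.coe_insert, Set.mem_insert_iff, Finset.mem_coe] at ha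
      rcases ha with rfl | ha
      · exact Submodule.zero_mem _
      · exact hT a ha
    have := Set.ncard_le_ncard hsub (Set.toFinite _)
    rwa [Set.ncard_coe_finset, ← Nat.card_coe_set_eq] at this
  rw [Finset.card_insert_of_notMem h0] at h1
  omega

theorem card_lt_two_pow_binRank_self {S : Finset W} (h0 : 0 ∉ S) : S.card < 2 ^ binRank S :=
  card_lt_two_pow_binRank h0 fun _ ha => Submodule.subset_span ha

theorem binRank_singleton {a : W} (ha : a ≠ 0) : binRank {a} = 1 := by
  have h := card_lt_two_pow_binRank_self (S := {a}) (by simpa using ha.symm)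
  refine le_antisymm (binRank_le_card {a}) (Nat.one_le_iff_ne_zero.mpr fun h' => ?_)
  simp [h'] at h

theorem two_le_binRank {S : Finset W} (h0 : 0 ∉ S) (hS : 2 ≤ S.card) : 2 ≤ binRank S := by
  have h2 := card_lt_two_pow_binRank_self h0
  by_contra! h
  have : 2 ^ binRank S ≤ 2 ^ 1 := Nat.pow_le_pow_right (by norm_num) (by omega)
  omega

theorem binRank_of_card_two {S : Finset W} (h0 : 0 ∉ S) (hS : S.card = 2) : binRank S = 2 :=
  le_antisymm ((binRank_le_card S).trans hS.le) (two_le_binRank h0 hS.ge)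

theorem three_le_binRank_of_subset_span {S T : Finset W} (h0 : 0 ∉ T)
    (hT : ∀ a ∈ T, a ∈ Submodule.span (ZMod 2) (S : Set W)) (hc : 4 ≤ T.card) :
    3 ≤ binRank S := by
  have h2 := card_lt_two_pow_binRank h0 hT
  by_contra! h
  have : 2 ^ binRank S ≤ 2 ^ 2 := Nat.pow_le_pow_right (by norm_num) (by omega)
  omega

theorem three_le_binRank {S : Finset W} (h0 : 0 ∉ S) (hS : 4 ≤ S.card) : 3 ≤ binRank S :=
  three_le_binRank_of_subset_span h0 (fun _ ha => Submodule.subset_span ha) hS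

theorem binRank_of_card_three [DecidableEq W] {S : Finset W} (h0 : 0 ∉ S) (hS : S.card = 3) :
    binRank S = if ∑ a ∈ S, a = 0 then 2 else 3 := by
  have h1 := binRank_le_card S
  rw [hS] at h1
  obtain ⟨a, b, c, hab, hac, hbc, rfl⟩ := Finset.card_eq_three.mp hS
  have hsum : ∑ z ∈ ({a, b, c} : Finset W), z = a + b + c := by
    rw [Finset.sum_insert (by simp [hab, hac]), Finset.sum_pair hbc, add_assoc]
  have h0' := h0
  simp only [Finset.mem_insert, Finset.mem_singleton, not_or] at h0'
  rw [hsum]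
  split_ifs with h
  · have hc : c = a + b := (add_eq_iff_of_binary.mpr h).symm
    refine le_antisymm ?_ (two_le_binRank h0 (by omega))
    have hle : Submodule.span (ZMod 2) (({a, b, c} : Finset W) : Set W) ≤
        Submodule.span (ZMod 2) (({a, b} : Finset W) : Set W) := by
      rw [Submodule.span_le]
      intro z hz
      simp only [Finset.coe_insert, Finset.coe_singleton, Set.mem_insert_iff,
        Set.mem_singleton_iff] at hz
      have ha : a ∈ Submodule.span (ZMod 2) (({a, b} : Finset W) : Set W) :=
        Submodule.subset_span (by simp)
      have hb : b ∈ Submodule.span (ZMod 2) (({a, b} : Finset W) : Set W) :=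
        Submodule.subset_span (by simp)
      rcases hz with rfl | rfl | rfl
      · exact ha
      · exact hb
      · rw [hc]
        exact Submodule.add_mem _ ha hb
    have : FiniteDimensional (ZMod 2) (Submodule.span (ZMod 2) (({a, b} : Finset W) : Set W)) :=
      FiniteDimensional.span_finset _ _
    exact (Submodule.finrank_mono hle).trans
      ((binRank_le_card {a, b}).trans (Finset.card_pair hab).le)
  · -- if the rank were at most 2, then `a + b` would be a fourth nonzero vector of the span
    refine le_antisymm h1 ?_
    have hab' : a + b ∉ ({a, b, c} : Finset W) := by
      simp only [Finset.mem_insert, Finset.mem_singleton, not_or]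
      refine ⟨fun h => h0'.2.1 ?_, fun h => h0'.1 ?_, fun h' => h (add_eq_iff_of_binary.mp h')⟩
      · exact (by simpa using h : b = 0).symm
      · exact (by simpa using h : a = 0).symm
    apply three_le_binRank_of_subset_span (T := insert (a + b) {a, b, c})
    · rw [Finset.mem_insert, not_or]
      exact ⟨fun h => hab (add_eq_zero_iff_of_binary.mp h.symm), h0⟩
    · intro z hz
      rcases Finset.mem_insert.mp hz with rfl | hz
      · exact Submodule.add_mem _ (Submodule.subset_span (by simp))
          (Submodule.subset_span (by simp))
      · exact Submodule.subset_span hz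
    · rw [Finset.card_insert_of_notMem hab', hS]

/-- The lines of a set `X` of nonzero vectors over the field with two elements: the triples of
distinct elements of `X` with sum zero. -/
def binLines [DecidableEq W] (X : Finset W) : Finset (Finset W) :=
  (X.powersetCard 3).filter fun S => ∑ a ∈ S, a = 0

/-- A sum over all subsets of `X` whose terms vanish in rank at least three runs over the empty
set, the points, the pairs and the lines of `X`. -/
theorem sum_powerset_eq_of_binRank_le_two [DecidableEq W] {M : Type*} [AddCommMonoid M]
    {X : Finset W} (h0 : 0 ∉ X) (f : Finset W → M) (hf : ∀ S ⊆ X, 3 ≤ binRank S → f S = 0) :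
    ∑ S ∈ X.powerset, f S =
      f ∅ + ∑ a ∈ X, f {a} + ∑ S ∈ X.powersetCard 2, f S + ∑ S ∈ binLines X, f S := by
  have hbig : ∀ S ∈ X.powerset, ¬ S.card ≤ 3 → f S = 0 := fun S hS h =>
    hf S (Finset.mem_powerset.mp hS)
      (three_le_binRank (fun h' => h0 (Finset.mem_powerset.mp hS h')) (by omega))
  have h1 : ∑ S ∈ X.powerset, f S = ∑ j ∈ Finset.range 4, ∑ S ∈ X.powersetCard j, f S := by
    rw [← Finset.sum_filter_add_sum_filter_not X.powerset (fun S => S.card ≤ 3),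
      Finset.sum_eq_zero (s := X.powerset.filter _)
        (fun S hS => hbig S (Finset.mem_filter.mp hS).1 (Finset.mem_filter.mp hS).2), add_zero,
      ← Finset.sum_fiberwise_of_maps_to (t := Finset.range 4) (g := Finset.card)
        (fun S hS => Finset.mem_range.mpr (by have := (Finset.mem_filter.mp hS).2; omega))]
    refine Finset.sum_congr rfl fun j hj => Finset.sum_congr ?_ fun _ _ => rfl
    ext S
    simp only [Finset.mem_filter, Finset.mem_powerset, Finset.mem_powersetCard]
    have := Finset.mem_range.mp hj
    constructor
    · tauto
    · rintro ⟨h, h'⟩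
      exact ⟨⟨h, by omega⟩, h'⟩
  have h3 : ∑ S ∈ X.powersetCard 3, f S = ∑ S ∈ binLines X, f S := by
    rw [binLines, Finset.sum_filter]
    refine Finset.sum_congr rfl fun S hS => ?_
    split_ifs with h
    · rfl
    · rw [Finset.mem_powersetCard] at hS
      refine hf S hS.1 ?_
      rw [binRank_of_card_three (fun h' => h0 (hS.1 h')) hS.2, if_neg h]
  rw [h1, Finset.sum_range_succ, Finset.sum_range_succ, Finset.sum_range_succ,
    Finset.sum_range_one, h3, Finset.powersetCard_zero, Finset.sum_singleton,
    Finset.powersetCard_one, Finset.sum_map]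
  rfl

/-- Projecting from a point `a ∈ X` identifies the other points of `X` in pairs, one for each
line of `X` through `a`. -/
theorem card_image_sym2_add_card_binLines [DecidableEq W] {X : Finset W} (h0 : 0 ∉ X) {a : W}
    (ha : a ∈ X) :
    ((X.erase a).image fun b => s(b, b + a)).card + ((binLines X).filter (a ∈ ·)).card =
      X.card - 1 := by
  have ha0 : a ≠ 0 := fun h => h0 (h ▸ ha)
  set Y := X.erase a with hY
  set f : W → Sym2 W := fun b => s(b, b + a) with hf
  have hff : ∀ b c, f c = f b ↔ c = b ∨ c = b + a := by
    intro b c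
    simp only [hf, Sym2.eq_iff]
    constructor
    · rintro (h | h)
      exacts [Or.inl h.1, Or.inr h.1]
    · rintro (rfl | rfl)
      · exact Or.inl ⟨rfl, rfl⟩
      · exact Or.inr ⟨rfl, by rw [add_assoc, add_self_of_binary, add_zero]⟩
  have hne : ∀ b, b ≠ b + a := fun b h => ha0 (by simpa using h)
  have hfib : ∀ b ∈ Y, Y.filter (f · = f b) = if b + a ∈ Y then {b, b + a} else {b} := by
    intro b hb
    ext c
    simp only [Finset.mem_filter, hff]
    split_ifs with h
    · simp only [Finset.mem_insert, Finset.mem_singleton]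
      exact ⟨fun h => h.2, fun h' => ⟨by rcases h' with rfl | rfl <;> assumption, h'⟩⟩
    · rw [Finset.mem_singleton]
      refine ⟨fun h' => h'.2.resolve_right ?_, fun h' => ⟨h' ▸ hb, Or.inl h'⟩⟩
      rintro rfl
      exact h h'.1
  have hcard : ∀ t ∈ Y.image f, (Y.filter (f · = t)).card =
      1 + if (Y.filter (f · = t)).card = 2 then 1 else 0 := by
    intro t ht
    obtain ⟨b, hb, rfl⟩ := Finset.mem_image.mp ht
    rw [hfib b hb]
    by_cases h : b + a ∈ Y
    · simp [h, Finset.card_pair (hne b)]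
    · simp [h]
  rw [← Finset.card_erase_of_mem ha, ← hY, Finset.card_eq_sum_card_image f Y,
    Finset.sum_congr rfl hcard, Finset.sum_add_distrib, Finset.sum_const, smul_eq_mul, mul_one,
    ← Finset.card_filter]
  congr 1
  symm
  have hfib2 : ∀ b ∈ Y, (Y.filter (f · = f b)).card = 2 → b + a ∈ Y := by
    intro b hb h
    by_contra h'
    rw [hfib b hb, if_neg h'] at h
    simp at h
  have haY : a ∉ Y := Finset.notMem_erase a X
  refine Finset.card_nbij (fun t => insert a (Y.filter (f · = t))) ?_ ?_ ?_
  · intro t ht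
    obtain ⟨ht, h2⟩ := Finset.mem_filter.mp ht
    obtain ⟨b, hb, rfl⟩ := Finset.mem_image.mp ht
    have hab := hfib2 b hb h2
    have haF : a ∉ Y.filter (f · = f b) := fun h => haY (Finset.mem_filter.mp h).1
    simp only [binLines, Finset.coe_filter, Finset.mem_filter, Finset.mem_powersetCard,
      Set.mem_ofPred_eq, Finset.mem_insert_self, and_true]
    refine ⟨⟨?_, by rw [Finset.card_insert_of_notMem haF, h2]⟩, ?_⟩
    · rw [Finset.insert_subset_iff]
      exact ⟨ha, (Finset.filter_subset _ _).trans (Finset.erase_subset _ _)⟩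
    · rw [Finset.sum_insert haF, hfib b hb, if_pos hab, Finset.sum_pair (hne b), ← add_assoc,
        add_comm a b, add_self_of_binary]
  · intro t ht t' ht' h
    have ht := Finset.mem_filter.mp ht
    obtain ⟨b, hb, rfl⟩ := Finset.mem_image.mp ht.1
    have hbm : b ∈ insert a (Y.filter (f · = t')) := by
      rw [← show insert a (Y.filter (f · = f b)) = insert a (Y.filter (f · = t')) from h]
      simp [hb]
    rcases Finset.mem_insert.mp hbm with rfl | hbm
    · exact absurd hb haY
    · exact (Finset.mem_filter.mp hbm).2
  · intro L hL
    simp only [binLines, Finset.coe_filter, Finset.mem_filter, Finset.mem_powersetCard,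
      Set.mem_ofPred_eq] at hL
    obtain ⟨⟨⟨hLX, hL3⟩, hsum⟩, haL⟩ := hL
    obtain ⟨b, c, hbc, hLe⟩ := Finset.card_eq_two.mp
      (show (L.erase a).card = 2 by rw [Finset.card_erase_of_mem haL, hL3])
    rw [← Finset.insert_erase haL, Finset.sum_insert (Finset.notMem_erase _ _), hLe,
      Finset.sum_pair hbc, ← add_assoc, ← add_eq_iff_of_binary, add_comm] at hsum
    have hsub : L.erase a ⊆ Y := Finset.erase_subset_erase a hLX
    have hb : b ∈ Y := hsub (by simp [hLe])
    have hc : b + a ∈ Y := hsum ▸ hsub (by simp [hLe])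
    have hF : Y.filter (f · = f b) = L.erase a := by
      rw [hfib b hb, if_pos hc, hLe, hsum]
    refine ⟨f b, ?_, ?_⟩
    · rw [Finset.coe_filter]
      refine ⟨Finset.mem_image_of_mem f hb, ?_⟩
      rw [hF, hLe, Finset.card_pair hbc]
    · change insert a (Y.filter (f · = f b)) = L
      rw [hF, Finset.insert_erase haL]

end BinaryRank

/-! ### A rank generating sum for families of binary vectors -/

section Enumeration

open Polynomial

/-- The sum of `(X - 1) ^ |B|` over the nonempty subsets `B` of a set is `X ^ k - 1`. -/
theorem sum_powerset_erase_empty_X_sub_one_pow {β : Type*} [DecidableEq β] (F : Finset β) :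
    ∑ B ∈ F.powerset.erase ∅, (X - 1 : ℤ[X]) ^ B.card = X ^ F.card - 1 := by
  have h := Finset.sum_pow_mul_eq_add_pow (X - 1 : ℤ[X]) 1 F
  simp only [one_pow, mul_one, sub_add_cancel] at h
  rw [← Finset.add_sum_erase _ _ (Finset.empty_mem_powerset F)] at h
  rw [← h]
  simp

/-- The sum of `(X - 1) ^ |B|` over the sets `B` with a given image `S` factors over `S`. -/
theorem sum_image_eq_X_sub_one_pow {β W : Type*} [DecidableEq β] [DecidableEq W] (E : Finset β)
    (x : β → W) (S : Finset W) :
    ∑ B ∈ E.powerset.filter (·.image x = S), (X - 1 : ℤ[X]) ^ B.card =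
      ∏ a ∈ S, (X ^ (E.filter (x · = a)).card - 1) := by
  induction S using Finset.induction_on with
  | empty =>
    have : E.powerset.filter (·.image x = ∅) = {∅} := by
      ext B
      simp only [Finset.image_eq_empty, Finset.mem_filter, Finset.mem_powerset,
        Finset.mem_singleton, and_iff_right_iff_imp]
      rintro rfl
      exact Finset.empty_subset _
    rw [this]
    simp
  | insert a S ha ih =>
    rw [Finset.prod_insert ha, ← ih, ← sum_powerset_erase_empty_X_sub_one_pow,
      Finset.sum_mul_sum, ← Finset.sum_product']
    refine Finset.sum_nbij' (fun B => (B.filter (x · = a), B.filter (x · ≠ a)))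
      (fun p => p.1 ∪ p.2) ?_ ?_ ?_ ?_ ?_
    · intro B hB
      obtain ⟨hBE, hB⟩ := Finset.mem_filter.mp hB
      rw [Finset.mem_powerset] at hBE
      have hmem : ∀ z, z ∈ B.image x ↔ z ∈ insert a S := fun z => by rw [hB]
      simp only [Finset.mem_image, Finset.mem_insert] at hmem
      simp only [Finset.mem_product, Finset.mem_erase, Finset.mem_powerset, Finset.mem_filter]
      refine ⟨⟨?_, Finset.filter_subset_filter _ hBE⟩, (Finset.filter_subset _ _).trans hBE, ?_⟩
      · obtain ⟨b, hb, hba⟩ := (hmem a).mpr (Or.inl rfl)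
        exact Finset.ne_empty_of_mem (Finset.mem_filter.mpr ⟨hb, hba⟩)
      · ext z
        simp only [Finset.mem_image, Finset.mem_filter]
        constructor
        · rintro ⟨b, ⟨hb, hba⟩, rfl⟩
          exact ((hmem _).mp ⟨b, hb, rfl⟩).resolve_left hba
        · intro hz
          obtain ⟨b, hb, rfl⟩ := (hmem z).mpr (Or.inr hz)
          exact ⟨b, ⟨hb, fun h => ha (h ▸ hz)⟩, rfl⟩
    · rintro ⟨B₁, B₂⟩ hB
      simp only [Finset.mem_product, Finset.mem_erase, Finset.mem_powerset,
        Finset.mem_filter] at hB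
      obtain ⟨⟨hne, h1⟩, h2, rfl⟩ := hB
      simp only [Finset.mem_filter, Finset.mem_powerset, Finset.image_union]
      refine ⟨Finset.union_subset (h1.trans (Finset.filter_subset _ _)) h2, ?_⟩
      rw [Finset.insert_eq]
      congr 1
      rw [Finset.eq_singleton_iff_nonempty_unique_mem]
      refine ⟨(Finset.nonempty_iff_ne_empty.mpr hne).image x, fun z hz => ?_⟩
      obtain ⟨b, hb, rfl⟩ := Finset.mem_image.mp hz
      exact (Finset.mem_filter.mp (h1 hb)).2
    · intro B _
      exact Finset.filter_union_filter_not_eq _ B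
    · rintro ⟨B₁, B₂⟩ hB
      simp only [Finset.mem_product, Finset.mem_erase, Finset.mem_powerset,
        Finset.mem_filter] at hB
      obtain ⟨⟨-, h1⟩, h2, rfl⟩ := hB
      have h1' : ∀ b ∈ B₁, x b = a := fun b hb => (Finset.mem_filter.mp (h1 hb)).2
      have h2' : ∀ b ∈ B₂, x b ≠ a := fun b hb h => ha (h ▸ Finset.mem_image_of_mem x hb)
      ext b
      · simp only [Finset.mem_filter, Finset.mem_union]
        exact ⟨fun h => h.1.resolve_right fun hb => h2' b hb h.2, fun h => ⟨Or.inl h, h1' b h⟩⟩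
      · simp only [Finset.mem_filter, Finset.mem_union]
        exact ⟨fun h => h.1.resolve_left fun hb => h.2 (h1' b hb), fun h => ⟨Or.inr h, h2' b h⟩⟩
    · intro B _
      rw [← pow_add, Finset.card_filter_add_card_filter_not]

/-- Sorting the sets of elements by their images: a sum over all `B ⊆ E` weighted by
`(X - 1) ^ (|B| - r(B))`, where the rank `r(B)` only depends on the image of `B`, becomes a sum
over the sets of images. -/
theorem sum_powerset_X_sub_one_pow {β W : Type*} [DecidableEq β] [DecidableEq W] (E : Finset β)
    (x : β → W) (r : Finset W → ℕ) (hr : ∀ S, r S ≤ S.card) (q : Finset W → ℤ[X]) :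
    ∑ B ∈ E.powerset, (X - 1 : ℤ[X]) ^ (B.card - r (B.image x)) * q (B.image x) =
      ∑ S ∈ (E.image x).powerset, (X - 1) ^ (S.card - r S) *
        (∏ a ∈ S, ∑ i ∈ Finset.range (E.filter (x · = a)).card, X ^ i) * q S := by
  rw [← Finset.sum_fiberwise_of_maps_to (t := (E.image x).powerset) (g := (·.image x))
    (fun B hB => Finset.mem_powerset.mpr (Finset.image_subset_image (Finset.mem_powerset.mp hB)))]
  refine Finset.sum_congr rfl fun S _ => ?_
  rw [Finset.sum_congr rfl (g := fun B : Finset β => (X - 1 : ℤ[X]) ^ (B.card - r S) * q S)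
    (fun B hB => by rw [(Finset.mem_filter.mp hB).2]), ← Finset.sum_mul]
  congr 1
  -- both sides agree after multiplication by the nonzero polynomial `(X - 1) ^ r(S)`
  apply mul_right_cancel₀ (pow_ne_zero (r S) (X_sub_C_ne_zero (1 : ℤ)))
  rw [C_1, Finset.sum_mul]
  calc _ = ∑ B ∈ E.powerset.filter (·.image x = S), (X - 1 : ℤ[X]) ^ B.card := by
        refine Finset.sum_congr rfl fun B hB => ?_
        have h : r S ≤ B.card := by
          rw [← (Finset.mem_filter.mp hB).2]
          exact (hr _).trans Finset.card_image_le
        rw [← pow_add, Nat.sub_add_cancel h]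
    _ = ∏ a ∈ S, ((∑ i ∈ Finset.range (E.filter (x · = a)).card, X ^ i) * (X - 1)) := by
        rw [sum_image_eq_X_sub_one_pow]
        simp only [geom_sum_mul]
    _ = _ := by
        rw [Finset.prod_mul_distrib, Finset.prod_const, mul_right_comm, ← pow_add,
          Nat.sub_add_cancel (hr S), mul_comm]

/-- The coefficient of `X ^ j` for an integer `j`, which is `0` for negative `j`. -/
def intCoeff (p : ℤ[X]) (j : ℤ) : ℤ := if 0 ≤ j then p.coeff j.toNat else 0

theorem coeff_X_sub_one_pow (d k : ℕ) :
    ((X - 1 : ℤ[X]) ^ d).coeff k = (-1) ^ (d - k) * (d.choose k : ℤ) := by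
  have := coeff_X_add_C_pow (-1 : ℤ) d k
  rwa [map_neg, C_1, ← sub_eq_add_neg] at this

theorem intCoeff_X_sub_one_pow_top (d : ℕ) : intCoeff ((X - 1) ^ d) d = 1 := by
  have := coeff_X_sub_one_pow d d
  simp_all [intCoeff]

theorem intCoeff_X_sub_one_pow_sub_one (d : ℕ) : intCoeff ((X - 1) ^ d) (d - 1) = -d := by
  rcases d with _ | d
  · simp [intCoeff]
  · have := coeff_X_sub_one_pow (d + 1) d
    simp_all [intCoeff]

theorem intCoeff_X_sub_one_pow_sub_two (d : ℕ) :
    intCoeff ((X - 1) ^ d) (d - 2) = (d.choose 2 : ℕ) := by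
  rcases d with _ | _ | d
  · simp [intCoeff]
  · simp [intCoeff]
  · have := coeff_X_sub_one_pow (d + 2) d
    have h2 : (d + 2).choose d = (d + 2).choose 2 := Nat.choose_symm_add
    have h3 : ((d + 1 + 1 : ℕ) : ℤ) - 2 = d := by push_cast; ring
    simp_all [intCoeff]

theorem intCoeff_X_sub_one_pow_of_lt {d : ℕ} {j : ℤ} (h : (d : ℤ) < j) :
    intCoeff ((X - 1) ^ d) j = 0 := by
  have := coeff_X_sub_one_pow d j.toNat
  rw [Nat.choose_eq_zero_of_lt (by omega)] at this
  simp_all [intCoeff]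

theorem coeff_zero_geom {k : ℕ} (hk : k ≠ 0) :
    (∑ i ∈ Finset.range k, (X : ℤ[X]) ^ i).coeff 0 = 1 := by
  simp [finsetSum_coeff, coeff_X_pow, Nat.pos_of_ne_zero hk]

theorem coeff_one_geom (k : ℕ) :
    (∑ i ∈ Finset.range k, (X : ℤ[X]) ^ i).coeff 1 = if 2 ≤ k then 1 else 0 := by
  simp [finsetSum_coeff, coeff_X_pow, Nat.lt_iff_add_one_le]

theorem coeff_one_prod {ι : Type*} [DecidableEq ι] (S : Finset ι) (p : ι → ℤ[X])
    (hp : ∀ a ∈ S, (p a).coeff 0 = 1) : (∏ a ∈ S, p a).coeff 1 = ∑ a ∈ S, (p a).coeff 1 := by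
  induction S using Finset.induction_on with
  | empty => simp [coeff_one]
  | insert a S ha ih =>
    have h0 : (∏ a ∈ S, p a).coeff 0 = 1 := by
      rw [coeff_zero_prod]
      exact Finset.prod_eq_one fun b hb => hp b (Finset.mem_insert_of_mem hb)
    rw [Finset.prod_insert ha, Finset.sum_insert ha, mul_coeff_one, h0,
      hp a (Finset.mem_insert_self a S), ih fun b hb => hp b (Finset.mem_insert_of_mem hb)]
    ring

theorem card_fibre_ne_zero {β W : Type*} [DecidableEq W] {E : Finset β} {x : β → W} {a : W}
    (ha : a ∈ E.image x) :
    (E.filter (x · = a)).card ≠ 0 := by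
  obtain ⟨b, hb, rfl⟩ := Finset.mem_image.mp ha
  exact Finset.card_ne_zero_of_mem (Finset.mem_filter.mpr ⟨hb, rfl⟩)

variable {β W : Type*} [DecidableEq W] [AddCommGroup W] [Module (ZMod 2) W]

/-- The coefficient of `X ^ i * Y ^ j`, for an integer `j`, in the sum of
`(X - 1) ^ (|B| - ρ(B)) * (Y - 1) ^ (r - ρ(B))` over all `B ⊆ E`, where `ρ(B)` is the rank of the
family of vectors `x b`, `b ∈ B`. -/
noncomputable def corankNullityCoeff (E : Finset β) (x : β → W) (r i : ℕ) (j : ℤ) : ℤ :=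
  ∑ B ∈ E.powerset, ((X - 1 : ℤ[X]) ^ (B.card - binRank (B.image x))).coeff i *
    intCoeff ((X - 1) ^ (r - binRank (B.image x))) j

/-- The sum of `(X - 1) ^ (|B| - ρ(B))` over the sets `B ⊆ E` with image `S`, in closed form. -/
noncomputable def imageWeight (E : Finset β) (x : β → W) (S : Finset W) : ℤ[X] :=
  (X - 1) ^ (S.card - binRank S) * ∏ a ∈ S, ∑ i ∈ Finset.range (E.filter (x · = a)).card, X ^ i

theorem corankNullityCoeff_eq_sum_image [DecidableEq β] (E : Finset β) (x : β → W)
    (r i : ℕ) (j : ℤ) :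
    corankNullityCoeff E x r i j = ∑ S ∈ (E.image x).powerset,
      (imageWeight E x S).coeff i * intCoeff ((X - 1) ^ (r - binRank S)) j := by
  have h := congrArg (fun p : ℤ[X] => p.coeff i) (sum_powerset_X_sub_one_pow E x binRank
    binRank_le_card fun S => C (intCoeff ((X - 1) ^ (r - binRank S)) j))
  simp only [finsetSum_coeff, coeff_mul_C] at h
  exact h

/-- If the `Y`-degree `j` is at least `r - 2`, only sets of rank at most two contribute. -/
theorem corankNullityCoeff_eq_of_sub_two_le [DecidableEq β] {E : Finset β} {x : β → W}
    (h0 : 0 ∉ E.image x) {r : ℕ} (hr : binRank (E.image x) ≤ r) (i : ℕ) {j : ℤ}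
    (hj : (r : ℤ) - 2 ≤ j) :
    corankNullityCoeff E x r i j =
      (imageWeight E x ∅).coeff i * intCoeff ((X - 1) ^ r) j +
      (∑ a ∈ E.image x, (imageWeight E x {a}).coeff i) * intCoeff ((X - 1) ^ (r - 1)) j +
      (∑ S ∈ (E.image x).powersetCard 2, (imageWeight E x S).coeff i +
        ∑ S ∈ binLines (E.image x), (imageWeight E x S).coeff i) *
          intCoeff ((X - 1) ^ (r - 2)) j := by
  rw [corankNullityCoeff_eq_sum_image, sum_powerset_eq_of_binRank_le_two h0, binRank_empty,
    Nat.sub_zero, add_mul, Finset.sum_mul, Finset.sum_mul, Finset.sum_mul, ← add_assoc]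
  · congr 1
    · congr 1
      · congr 1
        refine Finset.sum_congr rfl fun a ha => ?_
        rw [binRank_singleton fun h => h0 (h ▸ ha)]
      · refine Finset.sum_congr rfl fun S hS => ?_
        rw [Finset.mem_powersetCard] at hS
        rw [binRank_of_card_two (fun h => h0 (hS.1 h)) hS.2]
    · refine Finset.sum_congr rfl fun S hS => ?_
      rw [binLines, Finset.mem_filter, Finset.mem_powersetCard] at hS
      rw [binRank_of_card_three (fun h => h0 (hS.1.1 h)) hS.1.2, if_pos hS.2]
  · intro S hS h3
    have := binRank_mono hS
    rw [intCoeff_X_sub_one_pow_of_lt (by omega), mul_zero]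

theorem coeff_zero_imageWeight {E : Finset β} {x : β → W} {S : Finset W} (hS : S ⊆ E.image x) :
    (imageWeight E x S).coeff 0 = (-1) ^ (S.card - binRank S) := by
  rw [imageWeight, mul_coeff_zero, coeff_X_sub_one_pow, coeff_zero_prod,
    Finset.prod_eq_one fun a ha => coeff_zero_geom (card_fibre_ne_zero (hS ha))]
  simp

theorem coeff_one_imageWeight {E : Finset β} {x : β → W} {S : Finset W} (hS : S ⊆ E.image x) :
    (imageWeight E x S).coeff 1 =
      (-1) ^ (S.card - binRank S - 1) * ((S.card - binRank S : ℕ) : ℤ) +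
      (-1) ^ (S.card - binRank S) *
        ∑ a ∈ S, if 2 ≤ (E.filter (x · = a)).card then 1 else 0 := by
  have h0 : ∀ a ∈ S, (∑ i ∈ Finset.range (E.filter (x · = a)).card, (X : ℤ[X]) ^ i).coeff 0 = 1 :=
    fun a ha => coeff_zero_geom (card_fibre_ne_zero (hS ha))
  rw [imageWeight, mul_coeff_one, coeff_one_prod _ _ h0, coeff_X_sub_one_pow, coeff_X_sub_one_pow,
    coeff_zero_prod, Finset.prod_eq_one h0]
  simp only [coeff_one_geom]
  simp [add_comm]

/-- The five extremal coefficients, for a family `x` of nonzero binary vectors of rank at most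
`r`, in terms of the set of values of `x`. -/
theorem corankNullityCoeff_extremal [DecidableEq β] {E : Finset β} {x : β → W} (h0 : 0 ∉ E.image x)
    {r : ℕ} (hr : binRank (E.image x) ≤ r) (X' : Finset W) (hX : X' = E.image x)
    (N : Finset W) (hN : N = X'.filter fun a => 2 ≤ (E.filter (x · = a)).card) :
    corankNullityCoeff E x r 0 r = 1 ∧
    corankNullityCoeff E x r 0 (r - 1) = X'.card - r ∧
    corankNullityCoeff E x r 0 (r - 2) =
      (r.choose 2 : ℕ) - (r - 1) * X'.card + (X'.card.choose 2 : ℕ) - (binLines X').card ∧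
    corankNullityCoeff E x r 1 (r - 1) = N.card ∧
    corankNullityCoeff E x r 1 (r - 2) = -N.card * (r - 1) +
      ∑ a ∈ N, ((X'.erase a).image fun b => s(b, b + a)).card + (binLines X').card := by
  subst hX
  have hone : ∀ a ∈ E.image x, binRank {a} = 1 := fun a ha =>
    binRank_singleton fun h => h0 (h ▸ ha)
  have htwo : ∀ S ∈ (E.image x).powersetCard 2, S ⊆ E.image x ∧ S.card = 2 ∧ binRank S = 2 := by
    intro S hS
    rw [Finset.mem_powersetCard] at hS
    exact ⟨hS.1, hS.2, binRank_of_card_two (fun h => h0 (hS.1 h)) hS.2⟩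
  have hthree : ∀ S ∈ binLines (E.image x), S ⊆ E.image x ∧ S.card = 3 ∧ binRank S = 2 := by
    intro S hS
    rw [binLines, Finset.mem_filter, Finset.mem_powersetCard] at hS
    exact ⟨hS.1.1, hS.1.2,
      by rw [binRank_of_card_three (fun h => h0 (hS.1.1 h)) hS.1.2, if_pos hS.2]⟩
  -- the bound on the rank makes the truncated differences below harmless
  have hpos : (E.image x).Nonempty → 1 ≤ r := by
    rintro ⟨a, ha⟩
    rw [← hone a ha]
    exact (binRank_mono (Finset.singleton_subset_iff.mpr ha)).trans hr
  have hpos2 : ∀ S ⊆ E.image x, binRank S = 2 → 2 ≤ r := fun S hS h =>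
    h ▸ (binRank_mono hS).trans hr
  have hsmall : ¬ 2 ≤ r → (E.image x).powersetCard 2 = ∅ ∧ binLines (E.image x) = ∅ := fun h =>
    ⟨Finset.eq_empty_of_forall_notMem fun S hS => h (hpos2 S (htwo S hS).1 (htwo S hS).2.2),
      Finset.eq_empty_of_forall_notMem fun S hS => h (hpos2 S (hthree S hS).1 (hthree S hS).2.2)⟩
  set n : W → ℤ := fun a => if 2 ≤ (E.filter (x · = a)).card then 1 else 0 with hn
  have hNsum : ∀ f : W → ℤ, ∑ a ∈ E.image x, n a * f a = ∑ a ∈ N, f a := by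
    intro f
    rw [hN, Finset.sum_filter]
    refine Finset.sum_congr rfl fun a _ => ?_
    simp only [hn]
    split_ifs <;> simp
  -- the coefficients of `X ^ 0`
  have e0 : (imageWeight E x ∅).coeff 0 = 1 := by simp [coeff_zero_imageWeight]
  have e1 : ∑ a ∈ E.image x, (imageWeight E x {a}).coeff 0 = (E.image x).card := by
    rw [Finset.sum_congr rfl (g := fun _ => (1 : ℤ))]
    · simp
    · intro a ha
      rw [coeff_zero_imageWeight (Finset.singleton_subset_iff.mpr ha), hone a ha]
      simp
  have e2 : ∑ S ∈ (E.image x).powersetCard 2, (imageWeight E x S).coeff 0 =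
      ((E.image x).card.choose 2 : ℕ) := by
    rw [Finset.sum_congr rfl (g := fun _ => (1 : ℤ))]
    · simp
    · intro S hS
      obtain ⟨h1, h2, h3⟩ := htwo S hS
      rw [coeff_zero_imageWeight h1, h2, h3]
      simp
  have e3 : ∑ S ∈ binLines (E.image x), (imageWeight E x S).coeff 0 =
      -(binLines (E.image x)).card := by
    rw [Finset.sum_congr rfl (g := fun _ => (-1 : ℤ))]
    · simp
    · intro S hS
      obtain ⟨h1, h2, h3⟩ := hthree S hS
      rw [coeff_zero_imageWeight h1, h2, h3]
      simp
  -- the coefficients of `X ^ 1`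
  have d0 : (imageWeight E x ∅).coeff 1 = 0 := by simp [coeff_one_imageWeight]
  have d1 : ∑ a ∈ E.image x, (imageWeight E x {a}).coeff 1 = N.card := by
    have := hNsum 1
    simp only [Pi.one_apply, mul_one, Finset.sum_const, nsmul_eq_mul] at this
    rw [← this]
    refine Finset.sum_congr rfl fun a ha => ?_
    rw [coeff_one_imageWeight (Finset.singleton_subset_iff.mpr ha), hone a ha]
    simp only [hn, Finset.card_singleton, Finset.sum_singleton]
    ring
  have d23 : ∑ S ∈ (E.image x).powersetCard 2, (imageWeight E x S).coeff 1 +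
      ∑ S ∈ binLines (E.image x), (imageWeight E x S).coeff 1 =
      ∑ a ∈ N, (((E.image x).erase a).image fun b => s(b, b + a)).card +
        (binLines (E.image x)).card := by
    have h2 : ∑ S ∈ (E.image x).powersetCard 2, (imageWeight E x S).coeff 1 =
        ∑ S ∈ (E.image x).powersetCard 2, ∑ a ∈ S, n a := by
      refine Finset.sum_congr rfl fun S hS => ?_
      obtain ⟨h1, h2, h3⟩ := htwo S hS
      rw [coeff_one_imageWeight h1, h2, h3]
      simp [hn]
    have h3 : ∑ S ∈ binLines (E.image x), (imageWeight E x S).coeff 1 =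
        (binLines (E.image x)).card - ∑ S ∈ binLines (E.image x), ∑ a ∈ S, n a := by
      rw [← mul_one ((binLines (E.image x)).card : ℤ), ← nsmul_eq_mul, ← Finset.sum_const,
        ← Finset.sum_sub_distrib]
      refine Finset.sum_congr rfl fun S hS => ?_
      obtain ⟨h1, h2, h3⟩ := hthree S hS
      rw [coeff_one_imageWeight h1, h2, h3]
      simp only [hn]
      ring
    rw [h2, h3, sum_sum_eq_sum_mul_card (E.image x) _ fun S hS => (htwo S hS).1,
      sum_sum_eq_sum_mul_card (E.image x) _ fun S hS => (hthree S hS).1, hNsum, hNsum]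
    have hproj : ∀ a ∈ N, (((((E.image x).erase a).image fun b => s(b, b + a)).card : ℕ) : ℤ) =
        (((E.image x).powersetCard 2).filter (a ∈ ·)).card -
          ((binLines (E.image x)).filter (a ∈ ·)).card := by
      intro a ha
      have ha : a ∈ E.image x := by
        rw [hN] at ha
        exact (Finset.mem_filter.mp ha).1
      rw [card_pairs_filter_mem ha, ← card_image_sym2_add_card_binLines h0 ha]
      push_cast
      ring
    rw [Nat.cast_sum, Finset.sum_congr rfl hproj, Finset.sum_sub_distrib]
    ring
  -- the coefficients of powers of `Y - 1`
  have y1 : ∀ p : W → ℤ, (∑ a ∈ E.image x, p a) * intCoeff ((X - 1) ^ (r - 1)) (r - 1) =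
      ∑ a ∈ E.image x, p a := by
    intro p
    rcases (E.image x).eq_empty_or_nonempty with h | h
    · simp [h]
    · have := intCoeff_X_sub_one_pow_top (r - 1)
      rw [Nat.cast_sub (hpos h), Nat.cast_one] at this
      rw [this, mul_one]
  have y2 : ∀ p : W → ℤ, (∑ a ∈ E.image x, p a) * intCoeff ((X - 1) ^ (r - 1)) (r - 2) =
      (∑ a ∈ E.image x, p a) * -(r - 1) := by
    intro p
    rcases (E.image x).eq_empty_or_nonempty with h | h
    · simp [h]
    · have := intCoeff_X_sub_one_pow_sub_one (r - 1)
      rw [Nat.cast_sub (hpos h), Nat.cast_one, sub_sub, one_add_one_eq_two] at this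
      rw [this]
  have y3 : ∀ p : Finset W → ℤ, (∑ S ∈ (E.image x).powersetCard 2, p S +
      ∑ S ∈ binLines (E.image x), p S) * intCoeff ((X - 1) ^ (r - 2)) (r - 2) =
      ∑ S ∈ (E.image x).powersetCard 2, p S + ∑ S ∈ binLines (E.image x), p S := by
    intro p
    by_cases h : 2 ≤ r
    · have := intCoeff_X_sub_one_pow_top (r - 2)
      rw [Nat.cast_sub h, Nat.cast_two] at this
      rw [this, mul_one]
    · obtain ⟨e2, e3⟩ := hsmall h
      simp [e2, e3]
  have z1 : ∀ p : W → ℤ, (∑ a ∈ E.image x, p a) * intCoeff ((X - 1) ^ (r - 1)) r = 0 := by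
    intro p
    rcases (E.image x).eq_empty_or_nonempty with h | h
    · simp [h]
    · have := hpos h
      rw [intCoeff_X_sub_one_pow_of_lt (by omega), mul_zero]
  have z2 : ∀ (p : Finset W → ℤ) (j : ℤ), (r : ℤ) - 2 < j →
      (∑ S ∈ (E.image x).powersetCard 2, p S + ∑ S ∈ binLines (E.image x), p S) *
        intCoeff ((X - 1) ^ (r - 2)) j = 0 := by
    intro p j hj
    by_cases h : 2 ≤ r
    · rw [intCoeff_X_sub_one_pow_of_lt (by omega), mul_zero]
    · obtain ⟨e2, e3⟩ := hsmall h
      simp [e2, e3]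
  refine ⟨?_, ?_, ?_, ?_, ?_⟩
  · rw [corankNullityCoeff_eq_of_sub_two_le h0 hr _ (by omega), e0, z1, z2 _ _ (by omega),
      intCoeff_X_sub_one_pow_top]
    ring
  · rw [corankNullityCoeff_eq_of_sub_two_le h0 hr _ (by omega), e0, y1, e1, z2 _ _ (by omega),
      intCoeff_X_sub_one_pow_sub_one]
    ring
  · rw [corankNullityCoeff_eq_of_sub_two_le h0 hr _ le_rfl, e0, y2, e1, y3, e2, e3,
      intCoeff_X_sub_one_pow_sub_two]
    ring
  · rw [corankNullityCoeff_eq_of_sub_two_le h0 hr _ (by omega), d0, y1, d1, z2 _ _ (by omega)]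
    ring
  · rw [corankNullityCoeff_eq_of_sub_two_le h0 hr _ le_rfl, d0, y2, d1, y3, d23]
    ring

end Enumeration

/-! ### The cographic matroid over the field with two elements -/

section RankNullity

variable {M N : Type*} [AddCommGroup M] [Module (ZMod 2) M] [AddCommGroup N] [Module (ZMod 2) N]

theorem finrank_map_add_finrank_ker_inf [FiniteDimensional (ZMod 2) M] (f : M →ₗ[ZMod 2] N)
    (S : Submodule (ZMod 2) M) :
    finrank (ZMod 2) (S.map f) + finrank (ZMod 2) (LinearMap.ker f ⊓ S : Submodule (ZMod 2) M) =
      finrank (ZMod 2) S := by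
  have h := (f.domRestrict S).finrank_range_add_finrank_ker
  rw [LinearMap.range_domRestrict] at h
  rw [← h]
  congr 1
  rw [LinearMap.ker_domRestrict, ← Submodule.finrank_map_subtype_eq,
    Submodule.map_comap_subtype, inf_comm]

end RankNullity

/-- The functions that are constant along the edges of a graph form a space whose dimension is
the number of components. -/
theorem SimpleGraph.finrank_constant_along_edges {V : Type*} [Finite V] (H : SimpleGraph V)
    (S : Submodule (ZMod 2) (V → ZMod 2)) (hS : ∀ p, p ∈ S ↔ ∀ x y, H.Adj x y → p x = p y) :
    finrank (ZMod 2) S = Nat.card H.ConnectedComponent := by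
  have : Fintype H.ConnectedComponent := Fintype.ofFinite _
  rw [Nat.card_eq_fintype_card, ← finrank_fintype_fun_eq_card (ZMod 2)]
  have hinj : Function.Injective
      (LinearMap.funLeft (ZMod 2) (ZMod 2) H.connectedComponentMk) := by
    apply LinearMap.funLeft_injective_of_surjective
    rintro ⟨v⟩
    exact ⟨v, rfl⟩
  rw [← LinearMap.finrank_range_of_inj hinj]
  suffices h : S = LinearMap.range
      (LinearMap.funLeft (ZMod 2) (ZMod 2) H.connectedComponentMk) by rw [h]
  ext p
  rw [hS, LinearMap.mem_range]
  constructor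
  · intro h
    have hw : ∀ v w : V, H.Walk v w → p v = p w := by
      intro v w q
      induction q with
      | nil => rfl
      | cons hadj _ ih => exact (h _ _ hadj).trans ih
    exact ⟨fun c => c.lift p fun v w q _ => hw v w q, rfl⟩
  · rintro ⟨q, rfl⟩ x y hxy
    simp only [LinearMap.funLeft_apply]
    rw [ConnectedComponent.eq.mpr hxy.reachable]

namespace Graph

variable {α β : Type*} (G : Graph α β)

/-- The coboundary map over the field with two elements: it sends a function on the vertices to
the function on the edges whose value is the sum of the values at the two ends. -/
noncomputable def coboundary :
    (G.vertexSet → ZMod 2) →ₗ[ZMod 2] (G.edgeSet → ZMod 2) where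
  toFun p e := p ⟨_, (exists_isLink_of_mem_edgeSet e.2).choose_spec.choose_spec.left_mem⟩ +
    p ⟨_, (exists_isLink_of_mem_edgeSet e.2).choose_spec.choose_spec.right_mem⟩
  map_add' p q := by
    ext e
    simp only [Pi.add_apply]
    ring
  map_smul' c p := by
    ext e
    simp only [Pi.smul_apply, smul_eq_mul, RingHom.id_apply]
    ring

variable {G}

theorem coboundary_apply (p : G.vertexSet → ZMod 2) {e : β} {x y : α} (h : G.IsLink e x y) :
    G.coboundary p ⟨e, h.edge_mem⟩ = p ⟨x, h.left_mem⟩ + p ⟨y, h.right_mem⟩ := by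
  have h' := (exists_isLink_of_mem_edgeSet h.edge_mem).choose_spec.choose_spec
  rcases h'.eq_and_eq_or_eq_and_eq h with ⟨h1, h2⟩ | ⟨h1, h2⟩
  · exact congrArg₂ (p · + p ·) (Subtype.ext h1) (Subtype.ext h2)
  · exact (congrArg₂ (p · + p ·) (Subtype.ext h1) (Subtype.ext h2)).trans (add_comm _ _)

variable (G)

/-- The vector space representing the cographic matroid of `G` over the field with two elements:
the space of functions on the edges modulo the cuts. -/
abbrev CutQuotient : Type _ := (G.edgeSet → ZMod 2) ⧸ LinearMap.range G.coboundary

open Classical in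
/-- The vector representing the edge `e` in the cographic matroid of `G`; it is `0` if `e` is not
an edge. -/
noncomputable def edgeVector (e : β) : G.CutQuotient :=
  if h : e ∈ G.edgeSet then (LinearMap.range G.coboundary).mkQ (Pi.single ⟨e, h⟩ 1) else 0

variable {G}

/-- A set of edges is a cut if and only if its vectors sum to zero. -/
theorem sum_edgeVector_eq_zero_iff [DecidableEq β] {S : Finset β} (hS : ↑S ⊆ G.edgeSet) :
    ∑ e ∈ S, G.edgeVector e = 0 ↔
      ∃ p : α → ZMod 2, ∀ e x y, G.IsLink e x y → p x + p y = if e ∈ S then 1 else 0 := by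
  classical
  have h1 : ∑ e ∈ S, G.edgeVector e =
      (LinearMap.range G.coboundary).mkQ (fun e => if e.1 ∈ S then 1 else 0) := by
    have h2 : (fun e : G.edgeSet => if e.1 ∈ S then (1 : ZMod 2) else 0) =
        ∑ e ∈ S.attach, Pi.single (⟨e.1, hS e.2⟩ : G.edgeSet) (1 : ZMod 2) := by
      ext f
      rw [Finset.sum_apply]
      simp only [Pi.single_apply]
      split_ifs with h
      · rw [Finset.sum_eq_single ⟨f.1, h⟩]
        · simp
        · intro b _ hb
          rw [if_neg]
          rintro rfl
          exact hb rfl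
        · simp
      · rw [Finset.sum_eq_zero]
        intro b _
        rw [if_neg]
        rintro rfl
        exact h b.2
    rw [h2, map_sum, ← Finset.sum_attach]
    refine Finset.sum_congr rfl fun e _ => ?_
    rw [edgeVector, dif_pos (hS e.2)]
    congr!
  rw [h1, Submodule.mkQ_apply, Submodule.Quotient.mk_eq_zero, LinearMap.mem_range]
  constructor
  · rintro ⟨p, hp⟩
    refine ⟨fun x => if h : x ∈ G.vertexSet then p ⟨x, h⟩ else 0, fun e x y h => ?_⟩
    have := congrFun hp ⟨e, h.edge_mem⟩
    rw [coboundary_apply p h] at this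
    simpa only [h.left_mem, h.right_mem, dif_pos] using this
  · rintro ⟨p, hp⟩
    refine ⟨fun x => p x.1, ?_⟩
    ext ⟨e, he⟩
    obtain ⟨x, y, h⟩ := exists_isLink_of_mem_edgeSet he
    rw [coboundary_apply _ h]
    exact hp e x y h

/-- Deleting a set `B` of edges creates `|B| - ρ(B)` new components, where `ρ(B)` is the rank of
`B` in the cographic matroid. -/
theorem numComponents_deleteEdges_add_binRank [Finite G.vertexSet] [Finite G.edgeSet]
    [DecidableEq G.CutQuotient] {B : Finset β} (hB : ↑B ⊆ G.edgeSet) :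
    (G.deleteEdges B).numComponents + binRank (B.image G.edgeVector) =
      B.card + G.numComponents := by
  classical
  -- extension by zero of functions on `B`
  let j : (B → ZMod 2) →ₗ[ZMod 2] (G.edgeSet → ZMod 2) :=
    { toFun := fun w e => if h : e.1 ∈ B then w ⟨e.1, h⟩ else 0
      map_add' := fun v w => by ext e; simp only [Pi.add_apply]; split_ifs <;> simp
      map_smul' := fun c w => by
        ext e; simp only [Pi.smul_apply, RingHom.id_apply]; split_ifs <;> simp }
  have hj : ∀ w (e : G.edgeSet), j w e = if h : e.1 ∈ B then w ⟨e.1, h⟩ else 0 :=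
    fun _ _ => rfl
  have hjinj : Function.Injective j := by
    intro v w h
    ext ⟨e, he⟩
    have := congrFun h ⟨e, hB he⟩
    simpa [hj, he] using this
  have hjrange : ∀ w, w ∈ LinearMap.range j ↔ ∀ e : G.edgeSet, e.1 ∉ B → w e = 0 := by
    intro w
    constructor
    · rintro ⟨v, rfl⟩ e he
      rw [hj, dif_neg he]
    · intro h
      refine ⟨fun e => w ⟨e.1, hB e.2⟩, ?_⟩
      ext e
      rw [hj]
      split_ifs with he
      · rfl
      · exact (h e he).symm
  have hcard : finrank (ZMod 2) (LinearMap.range j) = B.card := by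
    rw [LinearMap.finrank_range_of_inj hjinj, finrank_fintype_fun_eq_card, Fintype.card_coe]
  have hspan : binRank (B.image G.edgeVector) = finrank (ZMod 2)
      ((LinearMap.range j).map (LinearMap.range G.coboundary).mkQ) := by
    rw [binRank, ← LinearMap.range_comp]
    suffices h : Submodule.span (ZMod 2) ↑(B.image G.edgeVector) =
        LinearMap.range ((LinearMap.range G.coboundary).mkQ ∘ₗ j) by rw [h]
    rw [LinearMap.range_eq_map ((LinearMap.range G.coboundary).mkQ ∘ₗ j),
      ← (Pi.basisFun (ZMod 2) B).span_eq, Submodule.map_span,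
      ← Set.range_comp]
    congr 1
    ext z
    simp only [Finset.coe_image, Set.mem_image, Finset.mem_coe, Set.mem_range,
      Function.comp_apply, Pi.basisFun_apply, LinearMap.comp_apply]
    have key : ∀ e (he : e ∈ B), G.edgeVector e =
        (LinearMap.range G.coboundary).mkQ (j (Pi.single ⟨e, he⟩ 1)) := by
      intro e he
      rw [edgeVector, dif_pos (hB he)]
      congr 1
      ext f
      rw [hj]
      by_cases hf : f = ⟨e, hB he⟩
      · subst hf
        simp [he]
      · rw [Pi.single_eq_of_ne hf]
        split_ifs with h
        · rw [Pi.single_eq_of_ne]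
          rintro h'
          exact hf (Subtype.ext (Subtype.mk.inj h'))
        · rfl
    constructor
    · rintro ⟨e, he, rfl⟩
      exact ⟨⟨e, he⟩, (key e he).symm⟩
    · rintro ⟨⟨e, he⟩, rfl⟩
      exact ⟨e, he, key e he⟩
  have hQ := finrank_map_add_finrank_ker_inf (LinearMap.range G.coboundary).mkQ (LinearMap.range j)
  rw [Submodule.ker_mkQ, hcard, ← hspan, ← Submodule.map_comap_eq] at hQ
  have hδ := finrank_map_add_finrank_ker_inf G.coboundary
    ((LinearMap.range j).comap G.coboundary)
  have hker : LinearMap.ker G.coboundary ⊓ (LinearMap.range j).comap G.coboundary =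
      LinearMap.ker G.coboundary := inf_eq_left.mpr (by
    intro p hp
    rw [Submodule.mem_comap, LinearMap.mem_ker.mp hp]
    exact Submodule.zero_mem _)
  have hc0 : finrank (ZMod 2) (LinearMap.ker G.coboundary) = G.numComponents := by
    apply SimpleGraph.finrank_constant_along_edges
    intro p
    rw [LinearMap.mem_ker]
    constructor
    · rintro h x y ⟨-, e, hl⟩
      have := congrFun h ⟨e, hl.edge_mem⟩
      rw [coboundary_apply p hl] at this
      exact add_eq_zero_iff_of_binary.mp this
    · intro h
      ext ⟨e, he⟩
      obtain ⟨x, y, hl⟩ := exists_isLink_of_mem_edgeSet he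
      rw [coboundary_apply p hl, Pi.zero_apply, add_eq_zero_iff_of_binary]
      by_cases hxy : x = y
      · subst hxy; rfl
      · exact h _ _ ⟨fun h => hxy (congrArg Subtype.val h), e, hl⟩
  have hcB : finrank (ZMod 2) ((LinearMap.range j).comap G.coboundary) =
      (G.deleteEdges B).numComponents := by
    refine SimpleGraph.finrank_constant_along_edges (V := G.vertexSet)
      (G.deleteEdges B).toSimpleGraph _ fun p => ?_
    rw [Submodule.mem_comap, hjrange]
    constructor
    · rintro h x y ⟨-, e, hl, heB⟩
      have := h ⟨e, hl.edge_mem⟩ (by simpa using heB)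
      rw [coboundary_apply p hl] at this
      exact add_eq_zero_iff_of_binary.mp this
    · rintro h ⟨e, he⟩ heB
      obtain ⟨x, y, hl⟩ := exists_isLink_of_mem_edgeSet he
      rw [coboundary_apply p hl, add_eq_zero_iff_of_binary]
      by_cases hxy : x = y
      · subst hxy; rfl
      · exact h _ _ ⟨fun h => hxy (congrArg Subtype.val h), e, hl, by simpa using heB⟩
  rw [hker, hc0, hcB] at hδ
  omega

end Graph

namespace Graph

variable {α β : Type*} {G : Graph α β}

/-! ### Series classes as fibres -/

section SeriesClasses

variable {τ : Type*} [DecidableEq τ] {H : Graph α β} {E : Finset β} {κ : β → τ}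

/-- If the relation "`{e, f}` disconnects" is the kernel of a function `κ` on the edges, then the
series classes are the nonempty fibres of `κ`. -/
theorem isSeriesClass_iff_fibre (hE : ↑E = H.edgeSet)
    (hκ : ∀ e ∈ E, ∀ f ∈ E, e ≠ f →
      (H.numComponents < (H.deleteEdges {e, f}).numComponents ↔ κ e = κ f)) (C : Set β) :
    H.IsSeriesClass C ↔ ∃ t ∈ E.image κ, ↑(E.filter (κ · = t)) = C := by
  have hP : ∀ D : Set β, (D.Nonempty ∧ D ⊆ H.edgeSet ∧ ∀ e ∈ D, ∀ f ∈ D, e ≠ f →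
      H.numComponents < (H.deleteEdges {e, f}).numComponents) ↔
      ∃ t ∈ E.image κ, D.Nonempty ∧ D ⊆ ↑(E.filter (κ · = t)) := by
    intro D
    rw [← hE]
    constructor
    · rintro ⟨⟨e, he⟩, hDE, h⟩
      refine ⟨κ e, Finset.mem_image_of_mem κ (hDE he), ⟨e, he⟩, fun f hf => ?_⟩
      rw [Finset.coe_filter]
      refine ⟨hDE hf, ?_⟩
      by_cases hfe : f = e
      · rw [hfe]
      · exact (hκ f (hDE hf) e (hDE he) hfe).mp (h f hf e he hfe)
    · rintro ⟨t, -, hne, h⟩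
      rw [Finset.coe_filter] at h
      exact ⟨hne, fun e he => (h he).1, fun e he f hf hef =>
        (hκ e (h he).1 f (h hf).1 hef).mpr ((h he).2.trans (h hf).2.symm)⟩
  have hfne : ∀ t ∈ E.image κ, (↑(E.filter (κ · = t)) : Set β).Nonempty := by
    intro t ht
    obtain ⟨e, he, rfl⟩ := Finset.mem_image.mp ht
    exact ⟨e, by simpa using he⟩
  simp only [IsSeriesClass, hP]
  constructor
  · rintro ⟨⟨t, ht, hne, hC⟩, hmax⟩
    exact ⟨t, ht, (hmax ⟨t, ht, hfne t ht, subset_rfl⟩ hC).antisymm hC⟩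
  · rintro ⟨t, ht, rfl⟩
    refine ⟨⟨t, ht, hfne t ht, subset_rfl⟩, ?_⟩
    rintro D ⟨t', -, -, hD⟩ hsub e he
    obtain ⟨f, hf⟩ := hfne t ht
    have h1 := hD (hsub hf)
    have h2 := hD he
    simp only [Finset.coe_filter, Set.mem_ofPred_eq] at hf h1 h2 ⊢
    exact ⟨h2.1, h2.2.trans (h1.2.symm.trans hf.2)⟩

theorem injOn_fibre (E : Finset β) (κ : β → τ) :
    Set.InjOn (fun t => (↑(E.filter (κ · = t)) : Set β)) ↑(E.image κ) := by
  intro t ht t' _ h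
  obtain ⟨e, he, rfl⟩ := Finset.mem_image.mp ht
  have : e ∈ (↑(E.filter (κ · = t')) : Set β) := by
    rw [← show (↑(E.filter (κ · = κ e)) : Set β) = ↑(E.filter (κ · = t')) from h]
    simpa using he
  simp only [Finset.coe_filter, Set.mem_ofPred_eq] at this
  exact this.2

theorem numSeriesClasses_eq_card_image (hE : ↑E = H.edgeSet)
    (hκ : ∀ e ∈ E, ∀ f ∈ E, e ≠ f →
      (H.numComponents < (H.deleteEdges {e, f}).numComponents ↔ κ e = κ f)) :
    H.numSeriesClasses = (E.image κ).card := by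
  have : {C | H.IsSeriesClass C} =
      (fun t => (↑(E.filter (κ · = t)) : Set β)) '' ↑(E.image κ) := by
    ext C
    rw [Set.mem_ofPred_eq, isSeriesClass_iff_fibre hE hκ]
    rfl
  rw [numSeriesClasses, this, (injOn_fibre E κ).ncard_image, Set.ncard_coe_finset]

end SeriesClasses

section Cographic

variable [Finite G.vertexSet] [Finite G.edgeSet] [DecidableEq G.CutQuotient]

/-- Deleting `B` from `G - A` creates new components if and only if `B` is dependent after
contracting `A` in the cographic matroid. -/
theorem numComponents_deleteEdges_lt_iff [DecidableEq β] {A B : Finset β} (hA : ↑A ⊆ G.edgeSet)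
    (hB : ↑B ⊆ G.edgeSet) (hAB : Disjoint A B) :
    (G.deleteEdges A).numComponents < ((G.deleteEdges A).deleteEdges B).numComponents ↔
      binRank ((A ∪ B).image G.edgeVector) < B.card + binRank (A.image G.edgeVector) := by
  have h1 := numComponents_deleteEdges_add_binRank hA
  have h2 := numComponents_deleteEdges_add_binRank (B := A ∪ B)
    (by rw [Finset.coe_union]; exact Set.union_subset hA hB)
  rw [Finset.card_union_of_disjoint hAB] at h2
  rw [deleteEdges_deleteEdges, ← Finset.coe_union]
  omega

/-- In a bridgeless graph, every edge has a nonzero vector in the cographic matroid. -/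
theorem IsBridgeless.edgeVector_ne_zero (hG : G.IsBridgeless) {e : β} (he : e ∈ G.edgeSet) :
    G.edgeVector e ≠ 0 := by
  intro h
  have h1 := numComponents_deleteEdges_add_binRank (G := G) (B := {e}) (by simpa using he)
  have h2 : binRank (({e} : Finset β).image G.edgeVector) = 0 := by
    rw [Finset.image_singleton, h]
    simp [binRank]
  rw [h2, Finset.card_singleton, Finset.coe_singleton] at h1
  exact hG e ⟨he, by omega⟩

theorem IsBridgeless.zero_notMem_image (hG : G.IsBridgeless) {B : Finset β}
    (hB : ↑B ⊆ G.edgeSet) : 0 ∉ B.image G.edgeVector := by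
  intro h
  obtain ⟨e, he, h⟩ := Finset.mem_image.mp h
  exact hG.edgeVector_ne_zero (hB he) h

/-- Two edges of a bridgeless graph are in series if and only if their vectors agree. -/
theorem IsBridgeless.lt_numComponents_deleteEdges_pair_iff (hG : G.IsBridgeless) {e f : β}
    (he : e ∈ G.edgeSet) (hf : f ∈ G.edgeSet) (hef : e ≠ f) :
    G.numComponents < (G.deleteEdges {e, f}).numComponents ↔ G.edgeVector e = G.edgeVector f := by
  classical
  have hsub : ↑({e, f} : Finset β) ⊆ G.edgeSet := by
    simp [Set.insert_subset_iff, he, hf]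
  have h := numComponents_deleteEdges_add_binRank hsub
  rw [Finset.card_pair hef, Finset.coe_pair] at h
  have h0 := hG.zero_notMem_image hsub
  have key : binRank (({e, f} : Finset β).image G.edgeVector) < 2 ↔
      G.edgeVector e = G.edgeVector f := by
    rw [Finset.image_insert, Finset.image_singleton] at h0 ⊢
    constructor
    · intro h
      by_contra hne
      rw [binRank_of_card_two h0 (Finset.card_pair hne)] at h
      omega
    · intro h
      rw [h, Finset.pair_eq_singleton]
      exact (binRank_le_card _).trans_lt (by simp)
  rw [← key]
  omega

/-- In `G - A`, where `A` is a series class of `G` with vector `a`, two edges are in series if and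
only if their vectors agree modulo `a`. -/
theorem IsBridgeless.lt_numComponents_deleteEdges_fibre_pair_iff (hG : G.IsBridgeless)
    {E : Finset β} (hE : ↑E = G.edgeSet) {a : G.CutQuotient} (ha : a ∈ E.image G.edgeVector)
    {e f : β} (he : e ∈ E.filter (G.edgeVector · ≠ a)) (hf : f ∈ E.filter (G.edgeVector · ≠ a))
    (hef : e ≠ f) :
    (G.deleteEdges ↑(E.filter (G.edgeVector · = a))).numComponents <
        ((G.deleteEdges ↑(E.filter (G.edgeVector · = a))).deleteEdges {e, f}).numComponents ↔
      s(G.edgeVector e, G.edgeVector e + a) = s(G.edgeVector f, G.edgeVector f + a) := by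
  classical
  obtain ⟨he, hea⟩ := Finset.mem_filter.mp he
  obtain ⟨hf, hfa⟩ := Finset.mem_filter.mp hf
  have hA : ↑(E.filter (G.edgeVector · = a)) ⊆ G.edgeSet := by
    rw [← hE]
    exact_mod_cast Finset.filter_subset _ _
  have hB : ↑({e, f} : Finset β) ⊆ G.edgeSet := by
    rw [← hE]
    simp [Set.insert_subset_iff, he, hf]
  have hdisj : Disjoint (E.filter (G.edgeVector · = a)) {e, f} := by
    simp [hea, hfa]
  have himA : (E.filter (G.edgeVector · = a)).image G.edgeVector = {a} := by
    rw [Finset.eq_singleton_iff_unique_mem]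
    obtain ⟨g, hg, hga⟩ := Finset.mem_image.mp ha
    refine ⟨Finset.mem_image.mpr ⟨g, by simp [hg, hga], hga⟩, fun z hz => ?_⟩
    obtain ⟨g', hg', rfl⟩ := Finset.mem_image.mp hz
    exact (Finset.mem_filter.mp hg').2
  have h0 : (0 : G.CutQuotient) ∉ ({a, G.edgeVector e, G.edgeVector f} : Finset _) := by
    have := hG.zero_notMem_image hE.subset
    intro h
    simp only [Finset.mem_insert, Finset.mem_singleton] at h
    rcases h with h | h | h
    · exact this (h ▸ ha)
    · exact this (h ▸ Finset.mem_image_of_mem _ he)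
    · exact this (h ▸ Finset.mem_image_of_mem _ hf)
  rw [← Finset.coe_pair, numComponents_deleteEdges_lt_iff hA hB hdisj, Finset.image_union, himA,
    Finset.card_pair hef, binRank_singleton (fun h => h0 (by simp [h])), Finset.image_insert,
    Finset.image_singleton, ← Finset.insert_eq, Sym2.eq_iff]
  by_cases h : G.edgeVector e = G.edgeVector f
  · rw [h, Finset.pair_eq_singleton]
    have := (binRank_le_card {a, G.edgeVector f}).trans Finset.card_le_two
    simp only [and_self, true_or, iff_true]
    omega
  · have h3 : ({a, G.edgeVector e, G.edgeVector f} : Finset _).card = 3 :=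
      Finset.card_eq_three.mpr ⟨_, _, _, Ne.symm hea, Ne.symm hfa, h, rfl⟩
    rw [binRank_of_card_three h0 h3, Finset.sum_insert (by simp [Ne.symm hea, Ne.symm hfa]),
      Finset.sum_pair h]
    have hadd : a + (G.edgeVector e + G.edgeVector f) = 0 ↔
        G.edgeVector e = G.edgeVector f + a := by
      rw [add_eq_zero_iff_of_binary, eq_comm, add_eq_iff_of_binary, add_assoc,
        add_eq_zero_iff_of_binary]
    split_ifs with hs
    · have h1 := hadd.mp hs
      simp only [Nat.reduceAdd, Nat.reduceLT, true_iff]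
      refine Or.inr ⟨h1, ?_⟩
      rw [h1, add_assoc, add_self_of_binary, add_zero]
    · have h1 := mt hadd.mpr hs
      simp [h, h1]

end Cographic

end Graph

/-! ### Theta classes are lines -/

theorem injective_of_sum_eq_zero {W : Type*} [AddCommGroup W] [Module (ZMod 2) W] {a : Fin 3 → W}
    (ha0 : ∀ i, a i ≠ 0) (hsum : a 0 + a 1 + a 2 = 0) : Function.Injective a := by
  have h01 : a 0 ≠ a 1 := fun h => ha0 2 (by
    rwa [add_eq_zero_iff_of_binary.mpr h, zero_add] at hsum)
  have h12 : a 1 ≠ a 2 := fun h => ha0 0 (by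
    rwa [add_assoc, add_eq_zero_iff_of_binary.mpr h, add_zero] at hsum)
  have h02 : a 0 ≠ a 2 := fun h => ha0 1 (by
    rwa [add_right_comm, add_eq_zero_iff_of_binary.mpr h, zero_add] at hsum)
  intro i i' h
  fin_cases i <;> fin_cases i'
  exacts [rfl, (h01 h).elim, (h02 h).elim, (h01 h.symm).elim, rfl, (h12 h).elim,
    (h02 h.symm).elim, (h12 h.symm).elim, rfl]

namespace Graph

variable {α β : Type*} {G : Graph α β}

/-- In a theta class, a function on the vertices of the theta graph pulls back to a cut of `G`. -/
theorem sum_edgeVector_eq_zero_of_theta [DecidableEq β] {C : Set β} (hCE : C ⊆ G.edgeSet)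
    {k : Fin 3 → ℕ} {φ : α → ThetaVertex} {ψ : β → Fin 3 × ℕ}
    (hlink : ∀ e ∈ C, ∀ x y, G.IsLink e x y → (thetaGraph k).IsLink (ψ e) (φ x) (φ y))
    (hreach : ∀ x y : (G.deleteEdges C).vertexSet,
      φ x = φ y ↔ (G.deleteEdges C).toSimpleGraph.Reachable x y)
    (q : ThetaVertex → ZMod 2) {S : Finset β} (hS : ↑S ⊆ C)
    (hq : ∀ e ∈ C, q (thetaPoint k (ψ e).1 (ψ e).2) + q (thetaPoint k (ψ e).1 ((ψ e).2 + 1)) =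
      if e ∈ S then 1 else 0) :
    ∑ e ∈ S, G.edgeVector e = 0 := by
  rw [sum_edgeVector_eq_zero_iff (hS.trans hCE)]
  refine ⟨fun x => q (φ x), fun e x y h => ?_⟩
  change q (φ x) + q (φ y) = _
  by_cases he : e ∈ C
  · rw [← hq e he]
    rcases Sym2.eq_iff.mp (hlink e he x y h).2 with ⟨h1, h2⟩ | ⟨h1, h2⟩
    · rw [h1, h2]
    · rw [h1, h2, add_comm]
  · rw [if_neg (fun h' : e ∈ S => he (hS h')), add_eq_zero_iff_of_binary]
    congr 1
    by_cases hxy : x = y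
    · rw [hxy]
    · refine (hreach ⟨x, h.left_mem⟩ ⟨y, h.right_mem⟩).mpr (SimpleGraph.Adj.reachable ?_)
      exact ⟨fun h' => hxy (congrArg Subtype.val h'), e, h, he⟩

theorem IsThetaClass.exists_mem_binLines [Finite G.vertexSet] [Finite G.edgeSet]
    [DecidableEq G.CutQuotient] (hG : G.IsBridgeless) {E : Finset β} (hE : ↑E = G.edgeSet)
    {C : Set β} (hC : G.IsThetaClass C) :
    ∃ L ∈ binLines (E.image G.edgeVector), ↑(E.filter (G.edgeVector · ∈ L)) = C := by
  classical
  obtain ⟨hCE, hbr, k, hk, φ, ψ, -, -, hψ, hlink, hreach⟩ := hC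
  have hcut := fun q S => sum_edgeVector_eq_zero_of_theta hCE hlink hreach q (S := S)
  have hψlt : ∀ e ∈ C, (ψ e).2 < k (ψ e).1 := fun e he => hψ.mapsTo he
  have hψinj : ∀ e ∈ C, ∀ f ∈ C, ψ e = ψ f → e = f := fun e he f hf h => hψ.injOn he hf h
  have hsurj : ∀ i j, ∃ e, j < k i → e ∈ C ∧ ψ e = (i, j) := by
    intro i j
    by_cases h : j < k i
    · obtain ⟨e, he, heq⟩ := hψ.surjOn (show (i, j) ∈ (thetaGraph k).edgeSet from h)
      exact ⟨e, fun _ => ⟨he, heq⟩⟩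
    · obtain ⟨e, -⟩ := hψ.surjOn (show ((0 : Fin 3), 0) ∈ (thetaGraph k).edgeSet from hk 0)
      exact ⟨e, fun h' => absurd h' h⟩
  choose ε hε using hsurj
  have hεeq : ∀ i j, j < k i → ∀ e ∈ C, (e = ε i j ↔ ψ e = (i, j)) := by
    intro i j h e he
    constructor
    · rintro rfl
      exact (hε i j h).2
    · intro h'
      exact hψinj e he _ (hε i j h).1 (h'.trans (hε i j h).2.symm)
  -- consecutive edges of a path of the theta graph form a cut around their common vertex
  have hstep : ∀ i j, j + 1 < k i → G.edgeVector (ε i j) = G.edgeVector (ε i (j + 1)) := by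
    intro i j h
    have hj : j < k i := by omega
    have hne : ε i j ≠ ε i (j + 1) := by
      intro h'
      have h1 := (hε i j hj).2
      rw [h', (hε i (j + 1) h).2] at h1
      simp at h1
    rw [← add_eq_zero_iff_of_binary, ← Finset.sum_pair hne]
    refine hcut (fun z => if z = .inner i (j + 1) then 1 else 0) _ ?_ fun e he => ?_
    · rw [Finset.coe_pair, Set.insert_subset_iff, Set.singleton_subset_iff]
      exact ⟨(hε i j hj).1, (hε i (j + 1) h).1⟩
    · have h1 := hψlt e he
      have e1 : thetaPoint k (ψ e).1 (ψ e).2 = .inner i (j + 1) ↔ ψ e = (i, j + 1) := by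
        rcases hpe : ψ e with ⟨i', j'⟩
        rw [hpe] at h1
        dsimp only at h1
        simp only [thetaPoint, Prod.mk.injEq]
        split_ifs with h2 h3
        · simp [h2]
        · omega
        · simp
      have e2 : thetaPoint k (ψ e).1 ((ψ e).2 + 1) = .inner i (j + 1) ↔ ψ e = (i, j) := by
        rcases hpe : ψ e with ⟨i', j'⟩
        rw [hpe] at h1
        dsimp only at h1
        simp only [thetaPoint, Prod.mk.injEq, Nat.add_eq_zero_iff, one_ne_zero, and_false,
          if_false]
        split_ifs with h3
        · simp only [false_iff, not_and]
          rintro rfl rfl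
          omega
        · simp
      simp only [Finset.mem_insert, Finset.mem_singleton, hεeq i j hj e he,
        hεeq i (j + 1) h e he, e1, e2]
      by_cases c1 : ψ e = (i, j)
      · simp [c1]
      · simp [c1]
  have hconst : ∀ i j, j < k i → G.edgeVector (ε i j) = G.edgeVector (ε i 0) := by
    intro i j
    induction j with
    | zero => exact fun _ => rfl
    | succ j ih => exact fun h => (hstep i j h).symm.trans (ih (by omega))
  have hvec : ∀ e ∈ C, G.edgeVector e = G.edgeVector (ε (ψ e).1 0) := by
    intro e he
    rw [← hconst _ _ (hψlt e he), ← (hεeq _ _ (hψlt e he) e he).mpr rfl]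
  set a : Fin 3 → G.CutQuotient := fun i => G.edgeVector (ε i 0) with ha
  have haE : ∀ i, ε i 0 ∈ E := fun i => by
    rw [← Finset.mem_coe, hE]
    exact hCE (hε i 0 (hk i)).1
  have ha0 : ∀ i, a i ≠ 0 := fun i => hG.edgeVector_ne_zero (hCE (hε i 0 (hk i)).1)
  have hεne : ∀ i i', i ≠ i' → ε i 0 ≠ ε i' 0 := by
    intro i i' h h'
    have h1 := (hε i 0 (hk i)).2
    rw [h', (hε i' 0 (hk i')).2] at h1
    exact h (congrArg Prod.fst h1).symm
  -- the first edges of the three paths form a cut around the branch vertex `u`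
  have hsum : a 0 + a 1 + a 2 = 0 := by
    have h01 := hεne 0 1 (by decide)
    have h02 := hεne 0 2 (by decide)
    have h12 := hεne 1 2 (by decide)
    have := hcut (fun z => if z = .u then 1 else 0) {ε 0 0, ε 1 0, ε 2 0} ?_ fun e he => ?_
    · rw [Finset.sum_insert (by simp [h01, h02]), Finset.sum_pair h12, ← add_assoc] at this
      exact this
    · simp only [Finset.coe_insert, Finset.coe_singleton, Set.insert_subset_iff,
        Set.singleton_subset_iff]
      exact ⟨(hε 0 0 (hk 0)).1, (hε 1 0 (hk 1)).1, (hε 2 0 (hk 2)).1⟩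
    · simp only [Finset.mem_insert, Finset.mem_singleton, hεeq 0 0 (hk 0) e he,
        hεeq 1 0 (hk 1) e he, hεeq 2 0 (hk 2) e he]
      have h1 := hψlt e he
      rcases ψ e with ⟨i', j'⟩
      have e2 : thetaPoint k i' (j' + 1) ≠ .u := by
        simp only [thetaPoint, Nat.add_eq_zero_iff, one_ne_zero, and_false, if_false]
        split_ifs <;> simp
      have e1 : thetaPoint k i' j' = .u ↔ j' = 0 := by
        simp only [thetaPoint]
        split_ifs <;> simp_all
      have e3 : ((i', j') = ((0 : Fin 3), 0) ∨ (i', j') = ((1 : Fin 3), 0) ∨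
          (i', j') = ((2 : Fin 3), 0)) ↔ j' = 0 := by
        simp only [Prod.mk.injEq]
        fin_cases i' <;> simp
      simp only [e1, e2, e3, if_false, add_zero]
  have hinj : Function.Injective a := injective_of_sum_eq_zero ha0 hsum
  set L : Finset G.CutQuotient := Finset.univ.image a with hL
  have hmemL : ∀ e ∈ C, G.edgeVector e ∈ L := fun e he => by
    rw [hvec e he]
    exact Finset.mem_image_of_mem a (Finset.mem_univ _)
  refine ⟨L, ?_, ?_⟩
  · rw [binLines, Finset.mem_filter, Finset.mem_powersetCard]
    refine ⟨⟨?_, ?_⟩, ?_⟩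
    · rintro z hz
      obtain ⟨i, -, rfl⟩ := Finset.mem_image.mp hz
      exact Finset.mem_image_of_mem _ (haE i)
    · rw [hL, Finset.card_image_of_injective _ hinj]
      rfl
    · rw [hL, Finset.sum_image hinj.injOn, Fin.sum_univ_three]
      exact hsum
  · apply Set.Subset.antisymm
    · intro f hf
      rw [Finset.coe_filter] at hf
      obtain ⟨hfE, hfL⟩ := hf
      -- an edge outside `C` with a vector in the span of `C` would be a bridge of `G - C`
      by_contra hfC
      have hCf : ↑(E.filter (· ∈ C)) = C := by
        ext e
        rw [Finset.coe_filter]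
        refine ⟨fun h => h.2, fun h => ⟨?_, h⟩⟩
        rw [← Finset.mem_coe, hE]
        exact hCE h
      have hfE' : f ∈ G.edgeSet := by rwa [← hE]
      apply hbr f
      refine ⟨⟨hfE', hfC⟩, ?_⟩
      have h1 := numComponents_deleteEdges_lt_iff (G := G) (A := E.filter (· ∈ C)) (B := {f})
        (by rw [hCf]; exact hCE) (by simpa using hfE') (by simp [hfC])
      rw [hCf, Finset.coe_singleton] at h1
      rw [h1, Finset.image_union, Finset.image_singleton, Finset.union_eq_left.mpr]
      · simp
      · rw [Finset.singleton_subset_iff]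
        obtain ⟨i, -, hi⟩ := Finset.mem_image.mp hfL
        exact Finset.mem_image.mpr
          ⟨ε i 0, Finset.mem_filter.mpr ⟨haE i, (hε i 0 (hk i)).1⟩, hi⟩
    · intro e he
      rw [Finset.coe_filter]
      refine ⟨?_, hmemL e he⟩
      rw [← Finset.mem_coe, hE]
      exact hCE he

end Graph

/-! ### Recognising theta graphs by their cuts -/

section ThetaRecognition

variable {β Q : Type*}

/-- The number of incidences of the vertex `q` with the edges in `A`, in the multigraph whose edge
`e` has the ends `l e` and `r e`. A loop counts twice. -/
def incidences [DecidableEq Q] (l r : β → Q) (A : Finset β) (q : Q) : ℕ :=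
  ∑ e ∈ A, ((if l e = q then 1 else 0) + (if r e = q then 1 else 0))

/-- A connected multigraph on `Q` with edges `F`, the edge `e` having the ends `l e` and `r e`,
whose edges are coloured with three colours `κ` such that, as in a theta graph coloured by its
three paths, every cut meets the three colours in the same parity, any three edges of distinct
colours form a cut, and there is one more edge than there are vertices. -/
structure HasThetaCuts [Fintype Q] (F : Finset β) (l r : β → Q) (κ : β → Fin 3) : Prop where
  card : F.card = Fintype.card Q + 1
  exists_colour : ∀ i, ∃ e ∈ F, κ e = i
  connected : ∀ p : Q → ZMod 2, (∀ e ∈ F, p (l e) = p (r e)) → ∀ q q', p q = p q'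
  cut_parity : ∀ (p : Q → ZMod 2) (i j : Fin 3),
    ∑ e ∈ F with κ e = i, (p (l e) + p (r e)) = ∑ e ∈ F with κ e = j, (p (l e) + p (r e))
  exists_cut : ∀ e : Fin 3 → β, (∀ i, e i ∈ F ∧ κ (e i) = i) →
    ∃ p : Q → ZMod 2, ∀ f ∈ F, p (l f) + p (r f) = 1 ↔ ∃ i, f = e i

theorem sum_ends_eq_sum_incidences [Fintype Q] [DecidableEq Q] (l r : β → Q) (A : Finset β)
    (p : Q → ZMod 2) :
    ∑ e ∈ A, (p (l e) + p (r e)) = ∑ q, p q * (incidences l r A q : ZMod 2) := by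
  simp only [incidences, Nat.cast_sum, Finset.mul_sum]
  rw [Finset.sum_comm]
  refine Finset.sum_congr rfl fun e _ => ?_
  simp [mul_add, Finset.sum_add_distrib]

theorem sum_incidences [Fintype Q] [DecidableEq Q] (l r : β → Q) (A : Finset β) :
    ∑ q, incidences l r A q = 2 * A.card := by
  simp only [incidences]
  rw [Finset.sum_comm]
  simp [Finset.sum_add_distrib, mul_comm]

theorem incidences_pos [DecidableEq Q] {l r : β → Q} {A : Finset β} {q : Q} :
    0 < incidences l r A q ↔ ∃ e ∈ A, q ∈ s(l e, r e) := by
  rw [incidences, Finset.sum_pos_iff]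
  refine exists_congr fun e => and_congr_right fun _ => ?_
  rw [Sym2.mem_iff]
  by_cases h1 : l e = q <;> by_cases h2 : r e = q <;> simp [h1, h2, @eq_comm _ q]

namespace HasThetaCuts

variable {F : Finset β} {l r : β → Q} {κ : β → Fin 3}

theorem exists_odd_cut [Fintype Q] (h : HasThetaCuts F l r κ) {i : Fin 3} {A : Finset β}
    (hA : A ⊆ F.filter (κ · = i)) (hne : A.Nonempty) :
    ∃ p : Q → ZMod 2, ∑ e ∈ A, (p (l e) + p (r e)) = 1 := by
  classical
  obtain ⟨e₀, he₀⟩ := hne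
  choose c hc using h.exists_colour
  have he₀' := Finset.mem_filter.mp (hA he₀)
  obtain ⟨p, hp⟩ := h.exists_cut (Function.update c i e₀) (by
    intro j
    by_cases hj : j = i
    · subst hj
      simpa using he₀'
    · simpa [hj] using hc j)
  refine ⟨p, ?_⟩
  rw [Finset.sum_eq_single_of_mem e₀ he₀]
  · exact (hp e₀ he₀'.1).mpr ⟨i, by simp⟩
  · intro f hf hne
    have hf' := Finset.mem_filter.mp (hA hf)
    have h1 : ¬ p (l f) + p (r f) = 1 := by
      rw [hp f hf'.1]
      rintro ⟨j, hj⟩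
      by_cases hji : j = i
      · subst hji
        simp only [Function.update_self] at hj
        exact hne hj
      · rw [Function.update_of_ne hji] at hj
        rw [hj, (hc j).2] at hf'
        exact hji hf'.2
    generalize p (l f) + p (r f) = z at h1
    revert h1
    decide +revert

/-- A set of edges of a single colour that has even degree at every vertex is orthogonal to all
cuts, hence empty. -/
theorem eq_empty_of_even [Fintype Q] [DecidableEq Q] (h : HasThetaCuts F l r κ)
    {i : Fin 3} {A : Finset β} (hA : A ⊆ F.filter (κ · = i))
    (heven : ∀ q, (incidences l r A q : ZMod 2) = 0) : A = ∅ := by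
  by_contra hne
  obtain ⟨p, hp⟩ := h.exists_odd_cut hA (Finset.nonempty_iff_ne_empty.mpr hne)
  rw [sum_ends_eq_sum_incidences] at hp
  simp [heven] at hp

theorem incidences_parity [Fintype Q] [DecidableEq Q] (h : HasThetaCuts F l r κ)
    (q : Q) (i j : Fin 3) :
    (incidences l r (F.filter (κ · = i)) q : ZMod 2) =
      (incidences l r (F.filter (κ · = j)) q : ZMod 2) := by
  have key : ∀ A, (incidences l r A q : ZMod 2) = ∑ e ∈ A,
      ((if l e = q then (1 : ZMod 2) else 0) + if r e = q then 1 else 0) := by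
    intro A
    simp [incidences]
  rw [key, key]
  exact h.cut_parity (fun q' => if q' = q then 1 else 0) i j

theorem incidences_eq_sum [DecidableEq Q] (q : Q) :
    incidences l r F q = ∑ i, incidences l r (F.filter (κ · = i)) q := by
  simp only [incidences]
  rw [Finset.sum_fiberwise]

/-- Every vertex has degree at least two, and at least three if its degrees in the three colours
are odd. -/
theorem degree_lower_bound [Fintype Q] [DecidableEq Q] (h : HasThetaCuts F l r κ) (q : Q) :
    2 + (if (incidences l r (F.filter (κ · = 0)) q : ZMod 2) = 1 then 1 else 0) ≤
      incidences l r F q := by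
  have hpos : 0 < incidences l r F q := by
    by_contra h0
    rw [incidences_pos] at h0
    push Not at h0
    obtain ⟨e, he, -⟩ := h.exists_colour 0
    have h1 : ∀ e ∈ F, l e ≠ q ∧ r e ≠ q := by
      intro e he
      have := h0 e he
      rw [Sym2.mem_iff, not_or] at this
      exact ⟨this.1 ∘ Eq.symm, this.2 ∘ Eq.symm⟩
    have h2 := h.connected (fun q' => if q' = q then 1 else 0)
      (fun e he => by simp [h1 e he]) q (l e)
    simp [h1 e he] at h2
  have h01 := h.incidences_parity q 0 1
  have h02 := h.incidences_parity q 0 2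
  have hsum := incidences_eq_sum (l := l) (r := r) (F := F) (κ := κ) q
  rw [Fin.sum_univ_three] at hsum
  rw [ZMod.natCast_eq_natCast_iff'] at h01 h02
  split_ifs with hodd
  · rw [← Nat.cast_one, ZMod.natCast_eq_natCast_iff'] at hodd
    omega
  · omega

/-- Exactly two vertices, the branch vertices, have one incidence with each colour; every other
vertex has two incidences, both with edges of the same colour. -/
theorem exists_branch_vertices [Fintype Q] [DecidableEq Q] (h : HasThetaCuts F l r κ) :
    ∃ u v : Q, u ≠ v ∧
      (∀ i q, (incidences l r (F.filter (κ · = i)) q : ZMod 2) =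
        (if q = u then 1 else 0) + (if q = v then 1 else 0)) ∧
      ∀ q, q ≠ u → q ≠ v → incidences l r F q = 2 := by
  classical
  set d : Q → ZMod 2 := fun q => (incidences l r (F.filter (κ · = 0)) q : ZMod 2) with hd
  have h01 : ∀ z : ZMod 2, z ≠ 1 → z = 0 := by decide
  obtain ⟨u, hu⟩ : ∃ u, d u = 1 := by
    by_contra hno
    push Not at hno
    have h0 := h.eq_empty_of_even subset_rfl fun q => h01 _ (hno q)
    obtain ⟨e, he, hκ⟩ := h.exists_colour 0
    exact Finset.notMem_empty e (h0 ▸ Finset.mem_filter.mpr ⟨he, hκ⟩)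
  have hsum : ∑ q, d q = 0 := by
    simp only [hd]
    rw [← Nat.cast_sum, sum_incidences, Nat.cast_mul]
    exact zero_mul _
  obtain ⟨v, hvu, hv⟩ : ∃ v, v ≠ u ∧ d v = 1 := by
    by_contra hno
    push Not at hno
    rw [Finset.sum_eq_single u (fun q _ hq => h01 _ (hno q hq)) (by simp), hu] at hsum
    exact one_ne_zero hsum
  -- the degree sum leaves no room for further odd vertices or larger degrees
  have hle : ∀ q ∈ Finset.univ, 2 + (if q ∈ ({u, v} : Finset Q) then 1 else 0) ≤
      incidences l r F q := by
    intro q _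
    refine le_trans (add_le_add_right ?_ 2) (h.degree_lower_bound q)
    have : q ∈ ({u, v} : Finset Q) → d q = 1 := by
      intro hq
      rcases Finset.mem_insert.mp hq with rfl | hq
      · exact hu
      · rw [Finset.mem_singleton.mp hq]
        exact hv
    split_ifs with h1 h2
    · exact le_rfl
    · exact absurd (this h1) h2
    · exact Nat.zero_le _
    · exact le_rfl
  have heq : ∑ q, (2 + (if q ∈ ({u, v} : Finset Q) then 1 else 0)) =
      ∑ q, incidences l r F q := by
    rw [sum_incidences, h.card, Finset.sum_add_distrib, Finset.sum_ite_mem, Finset.univ_inter,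
      Finset.sum_const, Finset.sum_const, Finset.card_pair hvu.symm, Finset.card_univ]
    simp only [smul_eq_mul]
    ring
  have hdeg := (Finset.sum_eq_sum_iff_of_le hle).mp heq
  refine ⟨u, v, hvu.symm, ?_, ?_⟩
  · intro i q
    rw [h.incidences_parity q i 0]
    by_cases hqu : q = u
    · subst hqu
      rw [if_pos rfl, if_neg hvu.symm, add_zero]
      exact hu
    by_cases hqv : q = v
    · subst hqv
      rw [if_pos rfl, if_neg hvu, zero_add]
      exact hv
    rw [if_neg hqu, if_neg hqv, add_zero]
    apply h01
    intro hq
    have h1 := h.degree_lower_bound q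
    rw [if_pos hq, ← hdeg q (Finset.mem_univ q), if_neg (by simp [hqu, hqv])] at h1
    omega
  · intro q hqu hqv
    rw [← hdeg q (Finset.mem_univ q), if_neg (by simp [hqu, hqv])]

/-- The simple graph formed by the edges of colour `i`. -/
def colourGraph (F : Finset β) (l r : β → Q) (κ : β → Fin 3) (i : Fin 3) : SimpleGraph Q :=
  SimpleGraph.fromRel fun q q' => ∃ e ∈ F, κ e = i ∧ s(l e, r e) = s(q, q')

theorem exists_edge_of_adj {i : Fin 3} {q q' : Q} (h : (colourGraph F l r κ i).Adj q q') :
    ∃ e ∈ F, κ e = i ∧ s(l e, r e) = s(q, q') := by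
  rw [colourGraph, SimpleGraph.fromRel_adj] at h
  obtain ⟨-, h | ⟨e, he, hi, h⟩⟩ := h
  · exact h
  · exact ⟨e, he, hi, h.trans Sym2.eq_swap⟩

/-- Each colour contains a path between the branch vertices, as otherwise the component of one of
them would have odd degree sum. -/
theorem reachable_branch_vertices [Fintype Q] [DecidableEq Q] {u v : Q} {i : Fin 3}
    (hodd : ∀ q, (incidences l r (F.filter (κ · = i)) q : ZMod 2) =
      (if q = u then 1 else 0) + (if q = v then 1 else 0)) :
    (colourGraph F l r κ i).Reachable u v := by
  classical
  set p : Q → ZMod 2 := fun q => if (colourGraph F l r κ i).Reachable u q then 1 else 0 with hp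
  have h1 : ∑ e ∈ F with κ e = i, (p (l e) + p (r e)) = 0 := by
    refine Finset.sum_eq_zero fun e he => ?_
    obtain ⟨he, hi⟩ := Finset.mem_filter.mp he
    have : p (l e) = p (r e) := by
      by_cases hlr : l e = r e
      · rw [hlr]
      · have hadj : (colourGraph F l r κ i).Adj (l e) (r e) := by
          rw [colourGraph, SimpleGraph.fromRel_adj]
          exact ⟨hlr, Or.inl ⟨e, he, hi, rfl⟩⟩
        simp only [hp]
        congr 1
        exact propext ⟨fun h => h.trans hadj.reachable, fun h => h.trans hadj.symm.reachable⟩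
    rw [this]
    exact add_self_of_binary _
  rw [sum_ends_eq_sum_incidences] at h1
  simp only [hodd, mul_add, Finset.sum_add_distrib, mul_ite, mul_one, mul_zero,
    Finset.sum_ite_eq', Finset.mem_univ, if_true] at h1
  rw [add_eq_zero_iff_of_binary] at h1
  by_contra hno
  simp only [hp, hno, SimpleGraph.Reachable.refl, if_true, if_false] at h1
  exact one_ne_zero h1

end HasThetaCuts

end ThetaRecognition

namespace Graph

theorem thetaPoint_eq_u_iff {k : Fin 3 → ℕ} {i : Fin 3} {j : ℕ} :
    thetaPoint k i j = .u ↔ j = 0 := by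
  simp only [thetaPoint]
  split_ifs <;> simp_all

theorem thetaPoint_eq_v_iff {k : Fin 3 → ℕ} {i : Fin 3} {j : ℕ} (hk : 1 ≤ k i) :
    thetaPoint k i j = .v ↔ j = k i := by
  simp only [thetaPoint]
  split_ifs with h1 h2
  · simp only [false_iff]
    omega
  · simp [h2]
  · simp [h2]

end Graph

section ThetaRecognition

theorem eq_of_sym2_eq_of_injOn {Q : Type*} {P : ℕ → Q} {n j j' : ℕ} (hP : Set.InjOn P {j | j ≤ n})
    (hj : j < n) (hj' : j' < n) (h : s(P j, P (j + 1)) = s(P j', P (j' + 1))) : j = j' := by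
  have hinj : ∀ a b, a ≤ n → b ≤ n → P a = P b → a = b := fun a b ha hb => @hP a ha b hb
  rcases Sym2.eq_iff.mp h with ⟨h1, -⟩ | ⟨h1, h2⟩
  · exact hinj _ _ hj.le hj'.le h1
  · have := hinj _ _ hj.le hj' h1
    have := hinj _ _ hj hj'.le h2
    omega

namespace HasThetaCuts

variable {β Q : Type*} [Fintype Q] [DecidableEq Q] {F : Finset β} {l r : β → Q} {κ : β → Fin 3}

theorem sum_range_add_succ_of_binary (f : ℕ → ZMod 2) (n : ℕ) :
    ∑ j ∈ Finset.range n, (f j + f (j + 1)) = f 0 + f n := by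
  induction n with
  | zero => rw [Finset.sum_range_zero, add_self_of_binary]
  | succ n ih =>
    rw [Finset.sum_range_succ, ih, add_assoc, ← add_assoc (f n), add_self_of_binary, zero_add]

/-- The edges of each colour form a path between the branch vertices: the edges outside a path of
that colour would have even degree everywhere. -/
theorem exists_path (h : HasThetaCuts F l r κ) {u v : Q} (huv : u ≠ v) {i : Fin 3}
    (hodd : ∀ q, (incidences l r (F.filter (κ · = i)) q : ZMod 2) =
      (if q = u then 1 else 0) + (if q = v then 1 else 0)) :
    ∃ (n : ℕ) (P : ℕ → Q) (ε : ℕ → β), 1 ≤ n ∧ P 0 = u ∧ P n = v ∧ Set.InjOn P {j | j ≤ n} ∧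
      (∀ j < n, ε j ∈ F ∧ κ (ε j) = i ∧ s(l (ε j), r (ε j)) = s(P j, P (j + 1))) ∧
      ∀ e ∈ F, κ e = i → ∃ j < n, ε j = e := by
  classical
  obtain ⟨w, hw⟩ := (reachable_branch_vertices hodd).exists_isPath
  have hinj : Set.InjOn w.getVert {j | j ≤ w.length} := hw.getVert_injOn
  have hex : ∀ j, ∃ e, j < w.length →
      e ∈ F ∧ κ e = i ∧ s(l e, r e) = s(w.getVert j, w.getVert (j + 1)) := by
    intro j
    by_cases hj : j < w.length
    · obtain ⟨e, he⟩ := exists_edge_of_adj (w.adj_getVert_succ hj)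
      exact ⟨e, fun _ => he⟩
    · obtain ⟨e, -⟩ := h.exists_colour 0
      exact ⟨e, fun h' => absurd h' hj⟩
  choose ε hε using hex
  have hεinj : ∀ j < w.length, ∀ j' < w.length, ε j = ε j' → j = j' := by
    intro j hj j' hj' he
    refine eq_of_sym2_eq_of_injOn hinj hj hj' ?_
    rw [← (hε j hj).2.2, he, (hε j' hj').2.2]
  set S : Finset β := (Finset.range w.length).image ε with hS
  have hSF : S ⊆ F.filter (κ · = i) := by
    intro e he
    obtain ⟨j, hj, rfl⟩ := Finset.mem_image.mp he
    have := hε j (Finset.mem_range.mp hj)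
    exact Finset.mem_filter.mpr ⟨this.1, this.2.1⟩
  have hSdeg : ∀ q, (incidences l r S q : ZMod 2) =
      (if q = u then 1 else 0) + (if q = v then 1 else 0) := by
    intro q
    rw [incidences, Finset.sum_image fun j hj j' hj' =>
      hεinj j (Finset.mem_range.mp hj) j' (Finset.mem_range.mp hj'), Nat.cast_sum]
    have hterm : ∀ j ∈ Finset.range w.length,
        (((if l (ε j) = q then 1 else 0) + (if r (ε j) = q then 1 else 0) : ℕ) : ZMod 2) =
        (if q = w.getVert j then 1 else 0) + (if q = w.getVert (j + 1) then 1 else 0) := by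
      intro j hj
      push_cast
      rcases Sym2.eq_iff.mp (hε j (Finset.mem_range.mp hj)).2.2 with ⟨h1, h2⟩ | ⟨h1, h2⟩
      · rw [h1, h2]
        simp only [eq_comm]
      · rw [h1, h2, add_comm]
        simp only [eq_comm]
    rw [Finset.sum_congr rfl hterm,
      sum_range_add_succ_of_binary (fun j => if q = w.getVert j then 1 else 0),
      SimpleGraph.Walk.getVert_zero, SimpleGraph.Walk.getVert_length]
  have hrest : F.filter (κ · = i) \ S = ∅ := by
    refine h.eq_empty_of_even Finset.sdiff_subset fun q => ?_
    have hsplit : incidences l r (F.filter (κ · = i) \ S) q + incidences l r S q =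
        incidences l r (F.filter (κ · = i)) q := Finset.sum_sdiff hSF
    have := congrArg (Nat.cast (R := ZMod 2)) hsplit
    rw [Nat.cast_add, hSdeg, hodd] at this
    simpa using this
  refine ⟨w.length, w.getVert, ε, ?_, w.getVert_zero, w.getVert_length, hinj, hε, ?_⟩
  · rw [Nat.one_le_iff_ne_zero]
    intro h0
    exact huv (SimpleGraph.Walk.eq_of_length_eq_zero h0)
  · intro e he hi
    have : e ∈ S := Finset.sdiff_eq_empty_iff_subset.mp hrest (Finset.mem_filter.mpr ⟨he, hi⟩)
    obtain ⟨j, hj, hje⟩ := Finset.mem_image.mp this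
    exact ⟨j, Finset.mem_range.mp hj, hje⟩

/-- A multigraph with the cuts of a theta graph is a theta graph. -/
theorem exists_theta (h : HasThetaCuts F l r κ) :
    ∃ k : Fin 3 → ℕ, (∀ i, 1 ≤ k i) ∧ ∃ (φ : Q → Graph.ThetaVertex) (ψ : β → Fin 3 × ℕ),
      Function.Injective φ ∧ (∀ q, φ q ∈ (Graph.thetaGraph k).vertexSet) ∧
      Set.SurjOn φ Set.univ (Graph.thetaGraph k).vertexSet ∧
      Set.BijOn ψ F (Graph.thetaGraph k).edgeSet ∧
      ∀ e ∈ F, (Graph.thetaGraph k).IsLink (ψ e) (φ (l e)) (φ (r e)) := by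
  obtain ⟨u, v, huv, hodd, htwo⟩ := h.exists_branch_vertices
  choose k P ε hk hPu hPv hPinj hε hcover using fun i => h.exists_path huv (hodd i)
  have hinj : ∀ i a b, a ≤ k i → b ≤ k i → P i a = P i b → a = b :=
    fun i a b ha hb => @hPinj i a ha b hb
  -- every inner vertex of a path is incident with the colour of the path
  have hinc : ∀ i j, j ≤ k i → 0 < incidences l r (F.filter (κ · = i)) (P i j) := by
    intro i j hj
    rw [incidences_pos]
    rcases hj.lt_or_eq with hj | rfl
    · obtain ⟨h1, h2, h3⟩ := hε i j hj
      exact ⟨ε i j, Finset.mem_filter.mpr ⟨h1, h2⟩, by rw [h3]; exact Sym2.mem_mk_left _ _⟩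
    · obtain ⟨h1, h2, h3⟩ := hε i (k i - 1) (by have := hk i; omega)
      refine ⟨ε i (k i - 1), Finset.mem_filter.mpr ⟨h1, h2⟩, ?_⟩
      rw [h3, Nat.sub_add_cancel (hk i)]
      exact Sym2.mem_mk_right _ _
  have hdisj : ∀ i i' j j', j ≤ k i → j' ≤ k i' → P i j = P i' j' → P i j ≠ u → P i j ≠ v →
      i = i' := by
    intro i i' j j' hj hj' he hu hv
    by_contra hne
    have h1 := hinc i j hj
    have h2 := hinc i' j' hj'
    rw [← he] at h2
    have h3 := htwo _ hu hv
    have h4 := hodd i (P i j)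
    have h5 := hodd i' (P i j)
    rw [if_neg hu, if_neg hv, add_zero, ZMod.natCast_eq_zero_iff] at h4 h5
    have hle : ∑ z ∈ {i, i'}, incidences l r (F.filter (κ · = z)) (P i j) ≤
        incidences l r F (P i j) := by
      rw [incidences_eq_sum (κ := κ)]
      exact Finset.sum_le_univ_sum_of_nonneg fun _ => Nat.zero_le _
    rw [Finset.sum_pair hne] at hle
    omega
  have hPiff : ∀ i i' j j', j ≤ k i → j' ≤ k i' →
      (P i j = P i' j' ↔ Graph.thetaPoint k i j = Graph.thetaPoint k i' j') := by
    have hu : ∀ i j, j ≤ k i → (P i j = u ↔ j = 0) := fun i j hj =>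
      ⟨fun h' => hinj i _ _ hj (Nat.zero_le _) (h'.trans (hPu i).symm), fun h' => h' ▸ hPu i⟩
    have hv : ∀ i j, j ≤ k i → (P i j = v ↔ j = k i) := fun i j hj =>
      ⟨fun h' => hinj i _ _ hj le_rfl (h'.trans (hPv i).symm), fun h' => h' ▸ hPv i⟩
    intro i i' j j' hj hj'
    by_cases h0 : j = 0
    · rw [(hu i j hj).mpr h0, Graph.thetaPoint_eq_u_iff.mpr h0, eq_comm, hu i' j' hj',
        @eq_comm _ Graph.ThetaVertex.u, Graph.thetaPoint_eq_u_iff]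
    by_cases h1 : j = k i
    · rw [(hv i j hj).mpr h1, (Graph.thetaPoint_eq_v_iff (hk i)).mpr h1, eq_comm, hv i' j' hj',
        @eq_comm _ Graph.ThetaVertex.v, Graph.thetaPoint_eq_v_iff (hk i')]
    simp only [Graph.thetaPoint]
    rw [if_neg h0, if_neg h1]
    have h0' := mt (hu i j hj).mp h0
    have h1' := mt (hv i j hj).mp h1
    constructor
    · intro he
      obtain rfl := hdisj i i' j j' hj hj' he h0' h1'
      obtain rfl := hinj i j j' hj hj' he
      rw [if_neg h0, if_neg h1]
    · split_ifs
      · simp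
      · simp
      · intro he
        injection he with e1 e2
        rw [e1, e2]
  have hsurj : ∀ q, ∃ i j, j ≤ k i ∧ P i j = q := by
    intro q
    have hpos : 0 < incidences l r F q := by
      have := h.degree_lower_bound q
      omega
    obtain ⟨e, he, hq⟩ := incidences_pos.mp hpos
    obtain ⟨j, hj, hje⟩ := hcover (κ e) e he rfl
    rw [← hje, (hε _ j hj).2.2, Sym2.mem_iff] at hq
    rcases hq with hq | hq
    exacts [⟨_, j, hj.le, hq.symm⟩, ⟨_, j + 1, hj, hq.symm⟩]
  choose ι pos hpos hP using hsurj
  have hcover' : ∀ e, ∃ j, e ∈ F → j < k (κ e) ∧ ε (κ e) j = e := by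
    intro e
    by_cases he : e ∈ F
    · obtain ⟨j, hj⟩ := hcover (κ e) e he rfl
      exact ⟨j, fun _ => hj⟩
    · exact ⟨0, fun h' => absurd h' he⟩
  choose idx hidx using hcover'
  have hφ : ∀ i j, j ≤ k i →
      Graph.thetaPoint k (ι (P i j)) (pos (P i j)) = Graph.thetaPoint k i j := fun i j hj =>
    (hPiff _ _ _ _ (hpos _) hj).mp (hP _)
  refine ⟨k, hk, fun q => Graph.thetaPoint k (ι q) (pos q), fun e => (κ e, idx e),
    ?_, ?_, ?_, ⟨?_, ?_, ?_⟩, ?_⟩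
  · intro q q' hq
    rw [← hP q, ← hP q']
    exact (hPiff _ _ _ _ (hpos q) (hpos q')).mpr hq
  · exact fun q => ⟨ι q, pos q, hpos q, rfl⟩
  · rintro _ ⟨i, j, hj, rfl⟩
    exact ⟨P i j, Set.mem_univ _, hφ i j hj⟩
  · exact fun e he => (hidx e he).1
  · intro e he e' he' heq
    have h1 : κ e = κ e' := congrArg Prod.fst heq
    have h2 : idx e = idx e' := congrArg Prod.snd heq
    rw [← (hidx e he).2, ← (hidx e' he').2, h1, h2]
  · rintro ⟨i, j⟩ hj
    obtain ⟨h1, h2, h3⟩ := hε i j hj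
    refine ⟨ε i j, h1, ?_⟩
    have h4 := hidx _ h1
    rw [h2] at h4
    refine Prod.ext h2 (eq_of_sym2_eq_of_injOn (hPinj i) h4.1 hj ?_)
    rw [← h3, ← (hε i _ h4.1).2.2, h4.2]
  · intro e he
    obtain ⟨h1, h2⟩ := hidx e he
    refine ⟨h1, ?_⟩
    have h3 := (hε _ _ h1).2.2
    rw [h2] at h3
    have h4 := congrArg (Sym2.map fun q => Graph.thetaPoint k (ι q) (pos q)) h3
    rw [Sym2.map_mk, Sym2.map_mk, hφ _ _ h1.le, hφ _ _ h1] at h4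
    exact h4

end HasThetaCuts

end ThetaRecognition

/-! ### Lines are theta classes -/

/-- Three nonzero binary vectors with sum zero satisfy no other linear relation. -/
theorem eq_of_sum_smul_eq_zero {W : Type*} [AddCommGroup W] [Module (ZMod 2) W] {a : Fin 3 → W}
    (ha0 : ∀ i, a i ≠ 0) (hsum : a 0 + a 1 + a 2 = 0) {t : Fin 3 → ZMod 2}
    (ht : ∑ i, t i • a i = 0) (i j : Fin 3) : t i = t j := by
  have hinj := injective_of_sum_eq_zero ha0 hsum
  have hne : ∀ i j, i ≠ j → a i + a j ≠ 0 := fun i j hij h =>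
    hij (hinj (add_eq_zero_iff_of_binary.mp h))
  have h01 := hne 0 1 (by decide)
  have h02 := hne 0 2 (by decide)
  have h12 := hne 1 2 (by decide)
  have hz : ∀ z : ZMod 2, z = 0 ∨ z = 1 := by decide
  rw [Fin.sum_univ_three] at ht
  suffices h : t 0 = t 1 ∧ t 1 = t 2 by
    obtain ⟨e1, e2⟩ := h
    fin_cases i <;> fin_cases j
    exacts [rfl, e1, e1.trans e2, e1.symm, rfl, e2, (e1.trans e2).symm, e2.symm, rfl]
  rcases hz (t 0) with h0 | h0 <;> rcases hz (t 1) with h1 | h1 <;>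
    rcases hz (t 2) with h2 | h2 <;>
    simp only [h0, h1, h2, zero_smul, one_smul, zero_add, add_zero, and_self] at ht ⊢
  exacts [(ha0 2 ht).elim, (ha0 1 ht).elim, (h12 ht).elim, (ha0 0 ht).elim, (h02 ht).elim,
    (h01 ht).elim]

namespace Graph

variable {α β : Type*} {G : Graph α β}

theorem IsConnected.numComponents_eq_one (hconn : G.IsConnected) : G.numComponents = 1 := by
  have := hconn.preconnected.subsingleton_connectedComponent
  have := hconn.nonempty
  rw [numComponents, Nat.card_eq_one_iff_unique]
  exact ⟨inferInstance, inferInstance⟩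

theorem IsLink.connectedComponentMk_eq {C : Set β} {e : β} {x y : G.vertexSet}
    (h : G.IsLink e x y) (he : e ∉ C) :
    (G.deleteEdges C).toSimpleGraph.connectedComponentMk x =
      (G.deleteEdges C).toSimpleGraph.connectedComponentMk y := by
  by_cases hxy : x = y
  · rw [hxy]
  · exact SimpleGraph.ConnectedComponent.eq.mpr
      (SimpleGraph.Adj.reachable ⟨hxy, e, h, he⟩)

/-- A function on the vertices that agrees at the ends of every edge is constant on components. -/
theorem eq_of_reachable {H : Graph α β} {γ : Type*} {p : H.vertexSet → γ}
    (hp : ∀ e (x y : H.vertexSet), H.IsLink e x y → p x = p y) {x y : H.vertexSet}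
    (h : H.toSimpleGraph.Reachable x y) : p x = p y := by
  obtain ⟨w⟩ := h
  induction w with
  | nil => rfl
  | cons hadj _ ih =>
    obtain ⟨-, e, he⟩ := hadj
    exact (hp e _ _ he).trans ih

/-- The contraction of `G` onto the components of `G - F`, where `F` is the union of the series
classes of a line, has the cuts of a theta graph. -/
theorem hasThetaCuts_of_line [Finite G.vertexSet] [Finite G.edgeSet] [DecidableEq G.CutQuotient]
    (hconn : G.IsConnected) {F : Finset β} (hF : ↑F ⊆ G.edgeSet)
    [Fintype (G.deleteEdges ↑F).toSimpleGraph.ConnectedComponent]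
    {a : Fin 3 → G.CutQuotient} (ha0 : ∀ i, a i ≠ 0) (hsum : a 0 + a 1 + a 2 = 0)
    {κ : β → Fin 3} (hκ : ∀ e ∈ F, G.edgeVector e = a (κ e)) (hcol : ∀ i, ∃ e ∈ F, κ e = i)
    (hrank : binRank (F.image G.edgeVector) = 2)
    {l r : β → G.vertexSet} (hlr : ∀ e ∈ F, G.IsLink e (l e) (r e)) :
    HasThetaCuts F (fun e => (G.deleteEdges ↑F).toSimpleGraph.connectedComponentMk (l e))
      (fun e => (G.deleteEdges ↑F).toSimpleGraph.connectedComponentMk (r e)) κ := by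
  classical
  set π : G.vertexSet → (G.deleteEdges ↑F).toSimpleGraph.ConnectedComponent :=
    (G.deleteEdges ↑F).toSimpleGraph.connectedComponentMk with hπ
  have hoff : ∀ e (x y : G.vertexSet), G.IsLink e x y → e ∉ F → π x = π y :=
    fun e x y h he => h.connectedComponentMk_eq (C := ↑F) (by simpa using he)
  have hends : ∀ e ∈ F, ∀ x y : G.vertexSet, G.IsLink e x y →
      (l e = x ∧ r e = y) ∨ (l e = y ∧ r e = x) := by
    intro e he x y h
    rcases (hlr e he).eq_and_eq_or_eq_and_eq h with ⟨h1, h2⟩ | ⟨h1, h2⟩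
    exacts [Or.inl ⟨Subtype.ext h1, Subtype.ext h2⟩, Or.inr ⟨Subtype.ext h1, Subtype.ext h2⟩]
  have hz : ∀ z : ZMod 2, (if z = 1 then (1 : ZMod 2) else 0) = z := by decide
  refine ⟨?_, hcol, ?_, ?_, ?_⟩
  · have h := numComponents_deleteEdges_add_binRank hF
    rw [hrank, hconn.numComponents_eq_one, numComponents, Nat.card_eq_fintype_card] at h
    omega
  · intro p hp q q'
    obtain ⟨x, rfl⟩ := q.exists_rep
    obtain ⟨y, rfl⟩ := q'.exists_rep
    refine eq_of_reachable (H := G) (p := fun x => p (π x)) ?_ (hconn.preconnected x y)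
    intro e x y h
    by_cases he : e ∈ F
    · rcases hends e he x y h with ⟨h1, h2⟩ | ⟨h1, h2⟩
      · rw [← h1, ← h2]
        exact hp e he
      · rw [← h1, ← h2]
        exact (hp e he).symm
    · rw [hoff e x y h he]
  · intro p
    refine eq_of_sum_smul_eq_zero ha0 hsum
      (t := fun i => ∑ e ∈ F with κ e = i, (p (π (l e)) + p (π (r e)))) ?_
    have hcut : ∑ e ∈ F.filter (fun e => p (π (l e)) + p (π (r e)) = 1), G.edgeVector e = 0 := by
      rw [sum_edgeVector_eq_zero_iff
        (subset_trans (by exact_mod_cast Finset.filter_subset _ _) hF)]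
      refine ⟨fun x => if h : x ∈ G.vertexSet then p (π ⟨x, h⟩) else 0, fun e x y h => ?_⟩
      simp only [h.left_mem, h.right_mem, dif_pos]
      by_cases he : e ∈ F
      · simp only [Finset.mem_filter, he, true_and, hz]
        rcases hends e he ⟨x, h.left_mem⟩ ⟨y, h.right_mem⟩ h with ⟨h1, h2⟩ | ⟨h1, h2⟩
        · rw [h1, h2]
        · rw [h1, h2, add_comm]
      · rw [if_neg (by simp [he]), hoff e ⟨x, h.left_mem⟩ ⟨y, h.right_mem⟩ h he]
        exact add_self_of_binary _
    rw [← hcut, Finset.sum_filter, ← Finset.sum_fiberwise F κ]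
    refine Finset.sum_congr rfl fun i _ => ?_
    rw [Finset.sum_smul]
    refine Finset.sum_congr rfl fun e he => ?_
    obtain ⟨he, hi⟩ := Finset.mem_filter.mp he
    rw [hκ e he, hi]
    rcases (by decide : ∀ z : ZMod 2, z = 0 ∨ z = 1) (p (π (l e)) + p (π (r e))) with h | h <;>
      simp [h]
  · intro e he
    have hinj : Function.Injective e := fun i j hij => by
      rw [← (he i).2, ← (he j).2, hij]
    have h0 : ∑ f ∈ Finset.univ.image e, G.edgeVector f = 0 := by
      rw [Finset.sum_image hinj.injOn, Fin.sum_univ_three, ← hsum]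
      simp only [hκ _ (he _).1, (he _).2]
    rw [sum_edgeVector_eq_zero_iff] at h0
    · obtain ⟨p, hp⟩ := h0
      have hmem : ∀ f, f ∈ Finset.univ.image e ↔ ∃ i, f = e i := by
        intro f
        simp [eq_comm]
      have hpc : ∀ x y : (G.deleteEdges ↑F).vertexSet,
          (G.deleteEdges ↑F).toSimpleGraph.Reachable x y → p x = p y := by
        intro x y
        refine eq_of_reachable (H := G.deleteEdges ↑F) (p := fun x => p x) ?_
        rintro f x y ⟨h, hf⟩
        have := hp f x y h
        rw [if_neg] at this
        · exact add_eq_zero_iff_of_binary.mp this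
        · rw [hmem]
          rintro ⟨i, rfl⟩
          exact hf (he i).1
      choose rep hrep using fun q : (G.deleteEdges ↑F).toSimpleGraph.ConnectedComponent =>
        q.exists_rep
      have hout : ∀ x, p (rep (π x)) = p x := fun x =>
        hpc _ _ (SimpleGraph.ConnectedComponent.eq.mp (hrep (π x)))
      refine ⟨fun q => p (rep q), fun f hf => ?_⟩
      change p (rep (π (l f))) + p (rep (π (r f))) = 1 ↔ _
      rw [hout, hout, hp f _ _ (hlr f hf), ← hmem]
      split_ifs with h <;> simp [h]
    · intro f hf
      simp only [Finset.coe_image, Set.mem_image] at hf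
      obtain ⟨i, -, rfl⟩ := hf
      exact hF (he i).1

/-- The union of the three series classes of a line is a theta class. -/
theorem isThetaClass_of_mem_binLines [Finite G.vertexSet] [Finite G.edgeSet]
    [DecidableEq G.CutQuotient] (hconn : G.IsConnected) (hG : G.IsBridgeless) {E : Finset β}
    (hE : ↑E = G.edgeSet) {L : Finset G.CutQuotient} (hL : L ∈ binLines (E.image G.edgeVector)) :
    G.IsThetaClass ↑(E.filter (G.edgeVector · ∈ L)) := by
  classical
  rw [binLines, Finset.mem_filter, Finset.mem_powersetCard] at hL
  obtain ⟨⟨hLX, hL3⟩, hLsum⟩ := hL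
  have h0L : 0 ∉ L := fun h => hG.zero_notMem_image hE.subset (hLX h)
  have hLrank : binRank L = 2 := by rw [binRank_of_card_three h0L hL3, if_pos hLsum]
  obtain ⟨a, haL, hsum, hainj⟩ : ∃ a : Fin 3 → G.CutQuotient, (∀ z, z ∈ L ↔ ∃ i, a i = z) ∧
      a 0 + a 1 + a 2 = 0 ∧ Function.Injective a := by
    obtain ⟨b, hb⟩ : ∃ b : Fin 3 ≃ L, True := ⟨(L.equivFinOfCardEq hL3).symm, trivial⟩
    refine ⟨fun i => b i, fun z => ⟨fun hz => ⟨b.symm ⟨z, hz⟩, by simp⟩, ?_⟩, ?_,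
      Subtype.val_injective.comp b.injective⟩
    · rintro ⟨i, rfl⟩
      exact (b i).2
    · rw [← Fin.sum_univ_three (fun i => (b i : G.CutQuotient)), ← hLsum,
        Equiv.sum_comp b (fun z => (z : G.CutQuotient)), Finset.sum_coe_sort L (fun z => z)]
  have ha0 : ∀ i, a i ≠ 0 := fun i h => h0L ((haL 0).mpr ⟨i, h⟩)
  set F := E.filter (G.edgeVector · ∈ L) with hFdef
  have hF : ↑F ⊆ G.edgeSet := by
    rw [← hE]
    exact_mod_cast Finset.filter_subset _ _
  have himF : F.image G.edgeVector = L := by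
    ext z
    rw [Finset.mem_image]
    constructor
    · rintro ⟨e, he, rfl⟩
      exact (Finset.mem_filter.mp he).2
    · intro hz
      obtain ⟨e, he, rfl⟩ := Finset.mem_image.mp (hLX hz)
      exact ⟨e, Finset.mem_filter.mpr ⟨he, hz⟩, rfl⟩
  have hκ : ∀ e, ∃ i, e ∈ F → G.edgeVector e = a i := by
    intro e
    by_cases he : e ∈ F
    · obtain ⟨i, hi⟩ := (haL _).mp (Finset.mem_filter.mp he).2
      exact ⟨i, fun _ => hi.symm⟩
    · exact ⟨0, fun h => absurd h he⟩
  choose κ hκ using hκ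
  have hcol : ∀ i, ∃ e ∈ F, κ e = i := by
    intro i
    have : a i ∈ F.image G.edgeVector := by
      rw [himF, haL]
      exact ⟨i, rfl⟩
    obtain ⟨e, he, hei⟩ := Finset.mem_image.mp this
    exact ⟨e, he, hainj ((hκ e he).symm.trans hei)⟩
  have hends : ∀ e, ∃ x y : G.vertexSet, e ∈ F → G.IsLink e x y := by
    intro e
    by_cases he : e ∈ F
    · obtain ⟨x, y, h⟩ := exists_isLink_of_mem_edgeSet (hF he)
      exact ⟨⟨x, h.left_mem⟩, ⟨y, h.right_mem⟩, fun _ => h⟩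
    · obtain ⟨x⟩ := hconn.nonempty
      exact ⟨x, x, fun h => absurd h he⟩
  choose l r hlr using hends
  have : Finite (G.deleteEdges ↑F).vertexSet := inferInstanceAs (Finite G.vertexSet)
  have : Fintype (G.deleteEdges ↑F).toSimpleGraph.ConnectedComponent := Fintype.ofFinite _
  obtain ⟨k, hk, φ, ψ, hφ, hφmem, hφsurj, hψ, hlink⟩ :=
    (hasThetaCuts_of_line hconn hF ha0 hsum hκ hcol (himF ▸ hLrank) hlr).exists_theta
  set π : G.vertexSet → (G.deleteEdges ↑F).toSimpleGraph.ConnectedComponent :=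
    (G.deleteEdges ↑F).toSimpleGraph.connectedComponentMk with hπ
  set Φ : α → ThetaVertex := fun x => if h : x ∈ G.vertexSet then φ (π ⟨x, h⟩) else .u with hΦ
  have hΦπ : ∀ x : G.vertexSet, Φ x = φ (π x) := fun x => by simp [hΦ]
  refine ⟨hF, ?_, k, hk, Φ, ψ, ?_, ?_, hψ, ?_, ?_⟩
  · rintro f ⟨⟨hf, hfF⟩, hlt⟩
    have h1 := (numComponents_deleteEdges_lt_iff hF (B := {f}) (by simpa using hf)
      (by simpa using hfF)).mp (by rwa [Finset.coe_singleton])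
    rw [Finset.image_union, himF, Finset.image_singleton, hLrank] at h1
    have hfL : G.edgeVector f ∉ L := fun h => hfF (Finset.mem_filter.mpr
      ⟨by rwa [← Finset.mem_coe, hE], h⟩)
    have h2 := three_le_binRank (S := L ∪ {G.edgeVector f})
      (by
        rw [Finset.mem_union, Finset.mem_singleton, not_or]
        exact ⟨h0L, (hG.edgeVector_ne_zero hf).symm⟩)
      (by
        rw [Finset.card_union_of_disjoint (by simpa using hfL), hL3]
        rfl)
    rw [Finset.card_singleton] at h1
    omega
  · intro x hx
    rw [hΦπ ⟨x, hx⟩]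
    exact hφmem _
  · intro t ht
    obtain ⟨q, -, rfl⟩ := hφsurj ht
    obtain ⟨x, rfl⟩ := q.exists_rep
    exact ⟨x, x.2, hΦπ x⟩
  · intro e he x y h
    have h1 := hlink e he
    rw [← hΦπ, ← hΦπ] at h1
    rcases (hlr e he).eq_and_eq_or_eq_and_eq h with ⟨e1, e2⟩ | ⟨e1, e2⟩
    · rwa [e1, e2] at h1
    · rw [e1, e2] at h1
      exact h1.symm
  · intro x y
    rw [hΦπ x, hΦπ y, hφ.eq_iff]
    exact SimpleGraph.ConnectedComponent.eq

end Graph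

namespace Graph

variable {α β : Type*} {G : Graph α β}

/-! ### The coefficients of the Tutte polynomial -/

theorem numComponents_le_ncard (H : Graph α β) [Finite H.vertexSet] :
    H.numComponents ≤ H.vertexSet.ncard := by
  rw [numComponents, ← Nat.card_coe_set_eq]
  exact Nat.card_le_card_of_surjective H.toSimpleGraph.connectedComponentMk
    fun c => c.exists_rep

theorem ncard_le_numComponents_of_edgeSet_eq_empty {H : Graph α β} [Finite H.vertexSet]
    (h : H.edgeSet = ∅) : H.vertexSet.ncard ≤ H.numComponents := by
  rw [numComponents, ← Nat.card_coe_set_eq]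
  refine Nat.card_le_card_of_injective H.toSimpleGraph.connectedComponentMk fun x y hxy => ?_
  refine eq_of_reachable (p := id) (fun e x y he => ?_) (SimpleGraph.ConnectedComponent.eq.mp hxy)
  have := he.edge_mem
  rw [h] at this
  exact this.elim

variable [Finite G.vertexSet] [Finite G.edgeSet] [DecidableEq G.CutQuotient]

/-- The rank of the cographic matroid of a connected graph is at most `m - n + 1`. -/
theorem binRank_add_ncard_le (hconn : G.IsConnected) {E : Finset β} (hE : ↑E = G.edgeSet) :
    binRank (E.image G.edgeVector) + G.vertexSet.ncard ≤ E.card + 1 := by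
  have h := numComponents_deleteEdges_add_binRank hE.subset
  rw [hconn.numComponents_eq_one] at h
  have : Finite (G.deleteEdges ↑E).vertexSet := inferInstanceAs (Finite G.vertexSet)
  have h2 : G.vertexSet.ncard ≤ _ :=
    ncard_le_numComponents_of_edgeSet_eq_empty (H := G.deleteEdges ↑E)
      (by rw [edgeSet_deleteEdges, hE, Set.sdiff_self])
  omega

open Polynomial in
theorem coeff_coeff_C_X_sub_one_pow_mul (a b i j : ℕ) :
    (((C X - 1 : ℤ[X][X]) ^ a * (X - 1) ^ b).coeff j).coeff i =
      ((X - 1 : ℤ[X]) ^ a).coeff i * ((X - 1 : ℤ[X]) ^ b).coeff j := by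
  have h1 : (C X - 1 : ℤ[X][X]) ^ a = C ((X - 1) ^ a) := by simp
  have h2 : (X - 1 : ℤ[X][X]) ^ b = ((X - 1 : ℤ[X]) ^ b).map C := by simp
  rw [h1, h2, coeff_C_mul, coeff_map, coeff_mul_C]

/-- Passing to complements writes the Tutte polynomial in terms of ranks in the cographic
matroid. -/
theorem tutteCoeff_eq_corankNullityCoeff [DecidableEq β] (hconn : G.IsConnected) {E : Finset β}
    (hE : ↑E = G.edgeSet) {r : ℕ} (hr : r + G.vertexSet.ncard = E.card + 1) (i : ℕ) (j : ℤ) :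
    G.tutteCoeff i j = corankNullityCoeff E G.edgeVector r i j := by
  have hpoly : G.tuttePoly = ∑ B ∈ E.powerset,
      (Polynomial.C Polynomial.X - 1) ^ (B.card - binRank (B.image G.edgeVector)) *
        (Polynomial.X - 1) ^ (r - binRank (B.image G.edgeVector)) := by
    classical
    have himage : 𝒫 G.edgeSet = (fun A : Finset β => (A : Set β)) '' ↑E.powerset := by
      ext A
      rw [← hE, Set.mem_powerset_iff, Set.mem_image]
      constructor
      · intro hA
        refine ⟨E.filter (· ∈ A), Finset.mem_powerset.mpr (Finset.filter_subset _ _), ?_⟩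
        ext e
        simp only [Finset.coe_filter, Set.mem_ofPred_eq]
        exact ⟨fun h => h.2, fun h => ⟨hA h, h⟩⟩
      · rintro ⟨B, hB, rfl⟩
        exact_mod_cast Finset.mem_powerset.mp hB
    rw [tuttePoly, himage, finsum_mem_image Finset.coe_injective.injOn, finsum_mem_coe_finset]
    refine Finset.sum_nbij' (E \ ·) (E \ ·) ?_ ?_ ?_ ?_ ?_
    · exact fun A _ => Finset.mem_powerset.mpr Finset.sdiff_subset
    · exact fun A _ => Finset.mem_powerset.mpr Finset.sdiff_subset
    · exact fun A hA => Finset.sdiff_sdiff_eq_self (Finset.mem_powerset.mp hA)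
    · exact fun A hA => Finset.sdiff_sdiff_eq_self (Finset.mem_powerset.mp hA)
    · intro A hA
      have hAE := Finset.mem_powerset.mp hA
      have h := numComponents_deleteEdges_add_binRank (G := G) (B := E \ A)
        (by rw [← hE]; exact_mod_cast Finset.sdiff_subset)
      have hres : (G.deleteEdges ↑(E \ A)) = G.restrict ↑A := by
        rw [restrict_eq_deleteEdges, ← hE, Finset.coe_sdiff]
      have : Finite (G.restrict ↑A).vertexSet := inferInstanceAs (Finite G.vertexSet)
      have hle : (G.restrict ↑A).numComponents ≤ G.vertexSet.ncard := numComponents_le_ncard _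
      have hcard : (E \ A).card + A.card = E.card := Finset.card_sdiff_add_card_eq_card hAE
      have hbound := (binRank_le_card ((E \ A).image G.edgeVector)).trans Finset.card_image_le
      rw [hres, hconn.numComponents_eq_one] at h
      have e1 : G.edgeRank G.edgeSet - G.edgeRank ↑A =
          (E \ A).card - binRank ((E \ A).image G.edgeVector) := by
        rw [edgeRank, edgeRank, restrict_self, hconn.numComponents_eq_one]
        omega
      have e2 : G.edgeNullity ↑A = r - binRank ((E \ A).image G.edgeVector) := by
        rw [edgeNullity, Set.ncard_coe_finset]
        omega
      rw [e1, e2]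
  rw [tutteCoeff, hpoly, corankNullityCoeff]
  simp only [intCoeff, Nat.cast_nonneg, true_and, Int.toNat_natCast, Polynomial.finsetSum_coeff,
    coeff_coeff_C_X_sub_one_pow_mul]
  split_ifs <;> simp

/-! ### Counting classes -/

theorem setOf_isNontrivialSeriesClass (hG : G.IsBridgeless) {E : Finset β}
    (hE : ↑E = G.edgeSet) :
    {C | G.IsNontrivialSeriesClass C} =
      (fun a => (↑(E.filter (G.edgeVector · = a)) : Set β)) ''
        ↑((E.image G.edgeVector).filter fun a => 2 ≤ (E.filter (G.edgeVector · = a)).card) := by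
  ext C
  simp only [Set.mem_ofPred_eq, IsNontrivialSeriesClass, Set.mem_image, Finset.mem_coe,
    Finset.mem_filter (s := E.image _)]
  rw [isSeriesClass_iff_fibre (κ := G.edgeVector) hE fun e he f hf =>
    hG.lt_numComponents_deleteEdges_pair_iff (hE.subset he) (hE.subset hf)]
  constructor
  · rintro ⟨⟨a, ha, rfl⟩, h⟩
    exact ⟨a, ⟨ha, Finset.one_lt_card_iff_nontrivial.mpr h⟩, rfl⟩
  · rintro ⟨a, ⟨ha, h⟩, rfl⟩
    exact ⟨⟨a, ha, rfl⟩, Finset.one_lt_card_iff_nontrivial.mp h⟩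

theorem numSeriesClasses_deleteEdges_fibre (hG : G.IsBridgeless) {E : Finset β}
    (hE : ↑E = G.edgeSet) {a : G.CutQuotient} (ha : a ∈ E.image G.edgeVector) :
    (G.deleteEdges ↑(E.filter (G.edgeVector · = a))).numSeriesClasses =
      (((E.image G.edgeVector).erase a).image fun b => s(b, b + a)).card := by
  classical
  have hE' : ↑(E.filter (G.edgeVector · ≠ a)) =
      (G.deleteEdges ↑(E.filter (G.edgeVector · = a))).edgeSet := by
    rw [edgeSet_deleteEdges, ← hE, ← Finset.coe_sdiff, Finset.filter_not]
  rw [numSeriesClasses_eq_card_image hE' (fun e he f hf hef =>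
    hG.lt_numComponents_deleteEdges_fibre_pair_iff hE ha he hf hef)]
  congr 1
  ext t
  simp only [Finset.mem_image, Finset.mem_filter, Finset.mem_erase]
  constructor
  · rintro ⟨e, ⟨he, hea⟩, rfl⟩
    exact ⟨_, ⟨hea, e, he, rfl⟩, rfl⟩
  · rintro ⟨_, ⟨hea, e, he, rfl⟩, rfl⟩
    exact ⟨e, ⟨he, hea⟩, rfl⟩

/-- The theta classes correspond to the lines formed by the edge vectors. -/
theorem numThetaClasses_eq_card_binLines (hconn : G.IsConnected) (hG : G.IsBridgeless)
    {E : Finset β} (hE : ↑E = G.edgeSet) :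
    G.numThetaClasses = (binLines (E.image G.edgeVector)).card := by
  have himage : {C | G.IsThetaClass C} =
      (fun L => (↑(E.filter (G.edgeVector · ∈ L)) : Set β)) ''
        (binLines (E.image G.edgeVector) : Set (Finset G.CutQuotient)) := by
    ext C
    rw [Set.mem_ofPred_eq, Set.mem_image]
    constructor
    · exact fun (hC : G.IsThetaClass C) => hC.exists_mem_binLines hG hE
    · rintro ⟨L, hL, rfl⟩
      exact isThetaClass_of_mem_binLines hconn hG hE hL
  rw [numThetaClasses, himage, Set.InjOn.ncard_image, Set.ncard_coe_finset]
  intro L hL L' hL' h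
  have hmem : ∀ L ∈ binLines (E.image G.edgeVector), ∀ z, z ∈ L ↔
      ∃ e ∈ (↑(E.filter (G.edgeVector · ∈ L)) : Set β), G.edgeVector e = z := by
    intro L hL z
    rw [binLines, Finset.mem_filter, Finset.mem_powersetCard] at hL
    simp only [Finset.coe_filter, Set.mem_ofPred_eq]
    constructor
    · intro hz
      obtain ⟨e, he, rfl⟩ := Finset.mem_image.mp (hL.1.1 hz)
      exact ⟨e, ⟨he, hz⟩, rfl⟩
    · rintro ⟨e, ⟨-, he⟩, rfl⟩
      exact he
  ext z
  rw [hmem L hL, hmem L' hL']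
  simp only [h]

end Graph

theorem theorem1 {α β : Type*} (G : Graph α β)
    (hV : G.vertexSet.Finite) (hE : G.edgeSet.Finite)
    (hloopless : G.Loopless) (hconn : G.IsConnected) (hbridgeless : G.IsBridgeless)
    (n m : ℕ) (hn : n = G.vertexSet.ncard) (hm : m = G.edgeSet.ncard) :
    G.tutteCoeff 0 ((m : ℤ) - n + 1) = 1 ∧
    G.tutteCoeff 0 ((m : ℤ) - n) = (n : ℤ) + G.numSeriesClasses - m - 1 ∧
    G.tutteCoeff 0 ((m : ℤ) - n - 1) =
      Ring.choose ((m : ℤ) - n + 1) 2 - ((m : ℤ) - n) * G.numSeriesClasses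
        + ((G.numSeriesClasses.choose 2 : ℕ) : ℤ) - G.numThetaClasses ∧
    G.tutteCoeff 1 ((m : ℤ) - n) = G.numNontrivialSeriesClasses ∧
    G.tutteCoeff 1 ((m : ℤ) - n - 1) =
      -(G.numNontrivialSeriesClasses : ℤ) * ((m : ℤ) - n)
        + (∑ᶠ A ∈ {A : Set β | G.IsNontrivialSeriesClass A},
            ((G.deleteEdges A).numSeriesClasses : ℤ))
        + G.numThetaClasses := by
  classical
  have : Finite G.vertexSet := hV
  have : Finite G.edgeSet := hE
  obtain ⟨E, hEG⟩ : ∃ E : Finset β, ↑E = G.edgeSet := ⟨hE.toFinset, hE.coe_toFinset⟩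
  have hmE : m = E.card := by rw [hm, ← hEG, Set.ncard_coe_finset]
  have hrank := Graph.binRank_add_ncard_le hconn hEG
  rw [← hn, ← hmE] at hrank
  obtain ⟨r, hr⟩ : ∃ r, r + n = m + 1 := ⟨m + 1 - n, by omega⟩
  have hrz : (m : ℤ) = r + n - 1 := by omega
  have hcoeff := Graph.tutteCoeff_eq_corankNullityCoeff hconn hEG (r := r) (by omega)
  have h0 := hcoeff 0
  have h1 := hcoeff 1
  rw [Nat.cast_zero] at h0
  rw [Nat.cast_one] at h1
  set X := E.image G.edgeVector with hX
  set N := X.filter fun a => 2 ≤ (E.filter (G.edgeVector · = a)).card with hN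
  have hinj : Set.InjOn (fun a => (↑(E.filter (G.edgeVector · = a)) : Set β)) ↑N :=
    (Graph.injOn_fibre E G.edgeVector).mono (by exact_mod_cast Finset.filter_subset _ _)
  have hs : G.numSeriesClasses = X.card :=
    Graph.numSeriesClasses_eq_card_image hEG fun e he f hf =>
      hbridgeless.lt_numComponents_deleteEdges_pair_iff (hEG.subset he) (hEG.subset hf)
  have hset := Graph.setOf_isNontrivialSeriesClass hbridgeless hEG
  have hsN : G.numNontrivialSeriesClasses = N.card := by
    rw [Graph.numNontrivialSeriesClasses, hset, hinj.ncard_image, Set.ncard_coe_finset]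
  have hsum : ∑ᶠ A ∈ {A : Set β | G.IsNontrivialSeriesClass A},
      ((G.deleteEdges A).numSeriesClasses : ℤ) =
        ∑ a ∈ N, ((X.erase a).image fun b => s(b, b + a)).card := by
    rw [hset, finsum_mem_image hinj, finsum_mem_coe_finset, Nat.cast_sum]
    refine Finset.sum_congr rfl fun a ha => ?_
    rw [Graph.numSeriesClasses_deleteEdges_fibre hbridgeless hEG (Finset.mem_filter.mp ha).1]
  have hθ : G.numThetaClasses = (binLines X).card :=
    Graph.numThetaClasses_eq_card_binLines hconn hbridgeless hEG
  obtain ⟨c1, c2, c3, c4, c5⟩ := corankNullityCoeff_extremal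
    (hbridgeless.zero_notMem_image hEG.subset) (r := r) (by rw [← hX]; omega) X hX N hN
  have e1 : (m : ℤ) - n + 1 = r := by omega
  have e2 : (m : ℤ) - n = r - 1 := by omega
  have e3 : (r : ℤ) - 1 - 1 = r - 2 := by ring
  rw [e1, e2, e3, h0, h0, h0, h1, h1, c1, c2, c3, c4, c5, hs, hsN, hθ, hsum,
    Ring.choose_natCast, hrz]
  refine ⟨rfl, by ring, by ring, rfl, by ring⟩
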